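/- **Setting.** Let $x=(x_1,\dots,x_n)\in\mathbb R^p$ with blocks $x_j\in\mathbb R^{p_j}$ and $y=(y_1,\dots,y_m)\in\mathbb R^d$ with blocks $y_i\in\mathbb R^{d_i}$ ($n,m\ge 1$), with Euclidean norms. Consider $$F^\star=\min_{x}\{F(x)=f(x)+h(x)+g(Kx)\},\qquad \min_y\{G(y)=\phi^*(-K^\top y)+g^*(y)\},\qquad \phi=f+h,$$ where $K\in\mathbb R^{d\times p}$, $^*$ denotes the Fenchel conjugate, and - $f(x)=\sum_{j=1}^n f_j(x_j)$, each $f_j:\mathbb R^{p_j}\to\mathbb R\cup\{+\infty\}$ is proper, closed and $\mu_{f_j}$-strongly convex with $\mu_{f_j}>0$; - $g(y)=\sum_{i=1}^m g_i(y_i)$, each $g_i:\mathbb R^{d_i}\to\mathbb R\cup\{+\infty\}$ is proper, closed and convex, and $g$ is $M_g$-Lipschitz continuous on all of $\mathbb R^d$ (hence finite everywhere, so the Slater condition $0\in\mathrm{ri}(\mathrm{dom}\,g-K\,\mathrm{dom}\,\phi)$ holds); - $h:\mathbb R^p\to\mathbb R$ is convex and differentiable, and for each $j$ the partial gradient $\nabla_{x_j}h$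 is $L_j^h$-Lipschitz with respect to changes of the $j$-th block, $L^h_j\ge0$; - the set of minimizers of $F$ is nonempty. Let $\sigma\in\mathbb R^n_{++}$, let $q_j=\frac1n$ for $j=1,\dots,n$, and let $\hat q$ be a probability vector on $\{1,\dots,m\}$ with positive entries. Put $$\bar L_\sigma=\|K\,\mathrm{diag}(1/\sqrt\sigma)\|^2,\quad L^h_\sigma=\max_j\tfrac{L_j^h}{\sigma_j},\quad \mu^f_\sigma=\min_j\tfrac{\mu_{f_j}}{\sigma_j},\quad \tau_0=\min\{\min_i\hat q_i,\min_j q_j\},\quad \|x\|_{\sigma/q}^2=\sum_j\tfrac{\sigma_j}{q_j}\|x_j\|^2,$$ and assume $\bar L_\sigma+L^h_\sigma>0$. Let $\rho_0>0$ with $8\bar L_\sigma\rho_0\le\mu^f_\sigma$, let $c>2$ with $c\tau_0>2$, and for $k\ge 0$ $$\tau_k=\frac{c\tau_0}{k+c},\qquad \rho_k=\frac{\rho_0\tau_0^2}{\tau_k^2},\qquad \beta_k=\frac1{2\bar L_\sigma\rho_k+L^h_\sigma},\qquad \eta_k=\frac{\rho_k}2 .$$ **Algorithm.** Let $x^0$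 satisfy $F(x^0)<+\infty$ and let $\hat y^0\in\mathbb R^d$. Set $\tilde x^0=x^0$, $y^0=\bar y^0=\hat y^0$. For $k=0,1,\dots$: $\hat x^k=(1-\tau_k)x^k+\tau_k\tilde x^k$; $\;y^{k+1}=\mathrm{prox}_{\rho_kg^*}(\hat y^k+\rho_kK\hat x^k)$; draw $j_k\in\{1,\dots,n\}$ with $\mathbb P(j_k=j)=q_j$, independently of all other draws; put $\tilde x^{k+1}_j=\tilde x^k_j$ for $j\ne j_k$ and, for $j=j_k$, $$\tilde x_j^{k+1}=\mathrm{prox}_{\frac{\tau_0\beta_k}{\sigma_j\tau_k}f_j}\Big(\tilde x^k_j-\tfrac{\tau_0\beta_k}{\sigma_j\tau_k}\big[\nabla_{x_j}h(\hat x^k)+K_j^\top y^{k+1}\big]\Big),$$ where $K_j$ is the $j$-th column block of $K$; $\;x^{k+1}=\hat x^k+\frac{\tau_k}{\tau_0}(\tilde x^{k+1}-\tilde x^k)$; with $\Theta_k=K[x^{k+1}-\hat x^k-(1-\tau_k)(x^k-\hat x^{k-1})]$, $$\hat y^{k+1}=\tfrac{\eta_k(1-\tau_k)}{\rho_{k-1}}\hat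 y^{k-1}+\big(1-\tfrac{\eta_k}{\rho_k}\big)\hat y^k+\tfrac{\eta_k}{\rho_k}y^{k+1}+\eta_k\Theta_k-\tfrac{\eta_k(1-\tau_k)}{\rho_{k-1}}y^k$$ (for $k=0$ with $\rho_{-1}:=\rho_0$, $\hat y^{-1}:=\hat y^0$, $\hat x^{-1}:=x^0$); $\;\bar y^{k+1}=(1-\tau_k)\bar y^k+\tau_ky^{k+1}$. Here $\mathrm{prox}_{\gamma\psi}(z)=\arg\min_u\{\gamma\psi(u)+\frac12\|u-z\|^2\}$. **Theorem.** For every $k\ge0$, $F(x^k)$ is almost surely finite and integrable, and for every minimizer $x^\star$ of $F$ and every minimizer $y^\star$ of $G$, $$\mathbb E[F(x^k)-F^\star]\le\frac{c^2\bar{\mathcal E}_0^2+c^2(M_g+\|y^\star\|)\,\bar{\mathcal E}_0\sqrt{2/\rho_0}}{(k+c-1)^2},$$ where $\bar{\mathcal E}_0\ge 0$ and $$\bar{\mathcal E}_0^2=F(x^0)-F^\star+\frac{\tau_0(L^h_\sigma+2\bar L_\sigma\rho_0+\mu^f_\sigma)}2\|x^0-x^\star\|^2_{\sigma/q}+\frac1{\rho_0}\|\hat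 y^0-y^\star\|^2.$$ Moreover $$\liminf_{k\to\infty}\;k^2\sqrt{\log k}\;\mathbb E[F(x^k)-F^\star]=0,$$ that is, $\mathbb E[F(x^k)]-F^\star=\underline{o}\big(1/(k^2\sqrt{\log k})\big)$, where $u_k=\underline o(v_k)$ means $\liminf_{k\to\infty}u_k/v_k=0$. -/

import Mathlib

open MeasureTheory ProbabilityTheory Filter Topology

noncomputable section

namespace SemiRandPD

section ConvexAnalysis

variable {E : Type*} [NormedAddCommGroup E] [InnerProductSpace ℝ E]

/-- A proper extended-real-valued function: nowhere `-∞` and not identically `+∞`. -/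
def IsProper (f : E → EReal) : Prop :=
  (∀ x, f x ≠ ⊥) ∧ ∃ x, f x ≠ ⊤

/-- A closed function is a lower semicontinuous one. -/
def IsClosedFun (f : E → EReal) : Prop :=
  LowerSemicontinuous f

/-- An extended-real-valued function is convex when its epigraph is convex. -/
def IsConvexFun (f : E → EReal) : Prop :=
  Convex ℝ {z : E × ℝ | f z.1 ≤ (z.2 : EReal)}

/-- `μ`-strong convexity: `f - (μ / 2) ‖·‖²` is convex. -/
def IsStronglyConvexFun (μ : ℝ) (f : E → EReal) : Prop :=
  IsConvexFun fun x => f x - ((μ / 2 * ‖x‖ ^ 2 : ℝ) : EReal)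

/-- `M`-Lipschitz continuity on the whole space.  A proper function with this property is finite
everywhere and satisfies `|f x - f y| ≤ M ‖x - y‖`. -/
def IsLipschitzFun (M : ℝ) (f : E → EReal) : Prop :=
  0 ≤ M ∧ ∀ x y, f x ≤ f y + ((M * ‖x - y‖ : ℝ) : EReal)

/-- The Fenchel conjugate `f*(y) = sup_x (⟪y, x⟫ - f x)`. -/
def conjugate (f : E → EReal) (y : E) : EReal :=
  ⨆ x, (((inner ℝ y x : ℝ) : EReal) - f x)

/-- `u = prox_{γ f}(z)`, that is, `u` minimizes `γ f(v) + (1/2) ‖v - z‖²` over `v`.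
For `γ > 0` and `f` proper, closed and convex there is exactly one such `u`. -/
def IsProx (γ : ℝ) (f : E → EReal) (z u : E) : Prop :=
  ∀ v, (γ : EReal) * f u + ((‖u - z‖ ^ 2 / 2 : ℝ) : EReal)
    ≤ (γ : EReal) * f v + ((‖v - z‖ ^ 2 / 2 : ℝ) : EReal)

end ConvexAnalysis

/-- The Euclidean space of vectors made of `n` blocks, the `j`-th one in `ℝ^{p_j}`. -/
abbrev BlockSpace {n : ℕ} (p : Fin n → ℕ) : Type :=
  PiLp 2 fun j => EuclideanSpace ℝ (Fin (p j))

/-- The embedding `U_j` of the `j`-th block: `d` in block `j`, zero in all other blocks. -/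
def blockEmbed {n : ℕ} {p : Fin n → ℕ} (j : Fin n) (d : EuclideanSpace ℝ (Fin (p j))) :
    BlockSpace p :=
  WithLp.toLp 2 (Pi.single j d)

/-- The block-diagonal map `x ↦ (w_j x_j)_j`. -/
def blockDiag {n : ℕ} (p : Fin n → ℕ) (w : Fin n → ℝ) : BlockSpace p →L[ℝ] BlockSpace p :=
  LinearMap.toContinuousLinearMap
    { toFun := fun x => WithLp.toLp 2 fun j => w j • x j
      map_add' := fun x y => by ext j; simp
      map_smul' := fun a x => by ext j; simp; ring }

/-- The weighted squared norm `∑_j w_j ‖x_j‖²`. -/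
def wnormSq {n : ℕ} {p : Fin n → ℕ} (w : Fin n → ℝ) (x : BlockSpace p) : ℝ :=
  ∑ j, w j * ‖x j‖ ^ 2

/-- The data of the composite problem `min_x f(x) + h(x) + g(K x)` with
`f(x) = ∑_j f_j(x_j)` and `g(y) = ∑_i g_i(y_i)`. -/
structure Problem (n m : ℕ) (p : Fin n → ℕ) (d : Fin m → ℕ) where
  fj : ∀ j, EuclideanSpace ℝ (Fin (p j)) → EReal
  gi : ∀ i, EuclideanSpace ℝ (Fin (d i)) → EReal
  h : BlockSpace p → ℝ
  K : BlockSpace p →L[ℝ] BlockSpace d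

namespace Problem

variable {n m : ℕ} {p : Fin n → ℕ} {d : Fin m → ℕ} (Q : Problem n m p d)

def f (x : BlockSpace p) : EReal := ∑ j, Q.fj j (x j)

def g (y : BlockSpace d) : EReal := ∑ i, Q.gi i (y i)

/-- `φ = f + h`. -/
def phi (x : BlockSpace p) : EReal := Q.f x + (Q.h x : EReal)

/-- The primal objective `F(x) = f(x) + h(x) + g(K x)`. -/
def F (x : BlockSpace p) : EReal := Q.phi x + Q.g (Q.K x)

/-- The dual objective `G(y) = φ*(-Kᵀ y) + g*(y)`. -/
def G (y : BlockSpace d) : EReal :=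
  conjugate Q.phi (-(ContinuousLinearMap.adjoint Q.K y)) + conjugate Q.g y

/-- `F* = inf_x F(x)`. -/
def Fstar : EReal := ⨅ x, Q.F x

def IsPrimalSolution (x : BlockSpace p) : Prop := ∀ x', Q.F x ≤ Q.F x'

def IsDualSolution (y : BlockSpace d) : Prop := ∀ y', Q.G y ≤ Q.G y'

/-- The standing assumptions on the functions: each `f_j` is proper, closed and `μ_j`-strongly
convex with `μ_j > 0`; each `g_i` is proper, closed and convex; `h` is convex and differentiable,
and its `j`-th partial gradient is `L_j`-Lipschitz in the `j`-th block. -/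
structure Assumptions (μ L : Fin n → ℝ) : Prop where
  fj_proper : ∀ j, IsProper (Q.fj j)
  fj_closed : ∀ j, IsClosedFun (Q.fj j)
  μ_pos : ∀ j, 0 < μ j
  fj_strong : ∀ j, IsStronglyConvexFun (μ j) (Q.fj j)
  gi_proper : ∀ i, IsProper (Q.gi i)
  gi_closed : ∀ i, IsClosedFun (Q.gi i)
  gi_convex : ∀ i, IsConvexFun (Q.gi i)
  h_convex : ConvexOn ℝ Set.univ Q.h
  h_diff : Differentiable ℝ Q.h
  L_nonneg : ∀ j, 0 ≤ L j
  h_smooth : ∀ (j : Fin n) (x : BlockSpace p) (t : EuclideanSpace ℝ (Fin (p j))),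
    ‖gradient Q.h (x + blockEmbed j t) j - gradient Q.h x j‖ ≤ L j * ‖t‖

/-- `L̄_σ = ‖K diag(1/√σ)‖²` (operator norm). -/
def Lbar (σ : Fin n → ℝ) : ℝ :=
  ‖Q.K.comp (blockDiag p fun j => 1 / √(σ j))‖ ^ 2

end Problem

/-- `L^h_σ = max_j L_j / σ_j`. -/
def Lh {n : ℕ} (L σ : Fin n → ℝ) : ℝ := ⨆ j, L j / σ j

/-- `μ^f_σ = min_j μ_j / σ_j`. -/
def muF {n : ℕ} (μ σ : Fin n → ℝ) : ℝ := ⨅ j, μ j / σ j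

/-- `τ₀ = min {min_i q̂_i, min_j q_j}`. -/
def tau0 {n m : ℕ} (qhat : Fin m → ℝ) (q : Fin n → ℝ) : ℝ := min (⨅ i, qhat i) (⨅ j, q j)

/-- A probability vector with positive entries. -/
def IsPosProb {n : ℕ} (q : Fin n → ℝ) : Prop := (∀ j, 0 < q j) ∧ ∑ j, q j = 1

/-- The parameter sequences used by the algorithm. -/
structure Params where
  τ : ℕ → ℝ
  ρ : ℕ → ℝ
  β : ℕ → ℝ
  η : ℕ → ℝ

/-- `τ_k = c τ₀ / (k + c)`, `ρ_k = ρ₀ τ₀² / τ_k²`, `β_k = 1 / (2 L̄_σ ρ_k + L^h_σ)` and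
`η_k = ρ_k / 2`, where `t0`, `Lb`, `Lσ` stand for `τ₀`, `L̄_σ`, `L^h_σ`. -/
def paramRule (c t0 ρ0 Lb Lσ : ℝ) : Params where
  τ := fun k => c * t0 / (k + c)
  ρ := fun k => ρ0 * t0 ^ 2 / (c * t0 / (k + c)) ^ 2
  β := fun k => 1 / (2 * Lb * (ρ0 * t0 ^ 2 / (c * t0 / (k + c)) ^ 2) + Lσ)
  η := fun k => ρ0 * t0 ^ 2 / (c * t0 / (k + c)) ^ 2 / 2

/-- The iterates of the semi-randomized primal-dual algorithm: `x = x^k`, `xt = x̃^k`,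
`xh = x̂^k`, `y = y^k`, `yh = ŷ^k`, `yb = ȳ^k`. -/
structure Iterates {n m : ℕ} (p : Fin n → ℕ) (d : Fin m → ℕ) where
  x : ℕ → BlockSpace p
  xt : ℕ → BlockSpace p
  xh : ℕ → BlockSpace p
  y : ℕ → BlockSpace d
  yh : ℕ → BlockSpace d
  yb : ℕ → BlockSpace d

/-- `S` is the run of the semi-randomized primal-dual algorithm on `Q` from `(x0, yh0)` with
parameters `A`, when the block drawn at iteration `k` is `jk k`.

In the multiplier update the index `k - 1` is truncated at `k = 0`.  This realizes the conventions
`ρ_{-1} = ρ_0`, `ŷ^{-1} = ŷ^0` and `x̂^{-1} = x^0` (note that `x̂^0 = x^0`), so that for `k = 0` the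
terms that refer to the past vanish. -/
structure IsRun {n m : ℕ} {p : Fin n → ℕ} {d : Fin m → ℕ} (Q : Problem n m p d)
    (σ : Fin n → ℝ) (t0 : ℝ) (A : Params) (x0 : BlockSpace p) (yh0 : BlockSpace d)
    (jk : ℕ → Fin n) (S : Iterates p d) : Prop where
  x_zero : S.x 0 = x0
  xt_zero : S.xt 0 = x0
  yh_zero : S.yh 0 = yh0
  y_zero : S.y 0 = yh0
  yb_zero : S.yb 0 = yh0
  xh_eq : ∀ k, S.xh k = (1 - A.τ k) • S.x k + A.τ k • S.xt k
  y_succ : ∀ k, IsProx (A.ρ k) (conjugate Q.g) (S.yh k + A.ρ k • Q.K (S.xh k)) (S.y (k + 1))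
  xt_keep : ∀ k j, j ≠ jk k → S.xt (k + 1) j = S.xt k j
  xt_draw : ∀ k j, j = jk k →
    IsProx (t0 * A.β k / (σ j * A.τ k)) (Q.fj j)
      (S.xt k j - (t0 * A.β k / (σ j * A.τ k)) •
        (gradient Q.h (S.xh k) j + ContinuousLinearMap.adjoint Q.K (S.y (k + 1)) j))
      (S.xt (k + 1) j)
  x_succ : ∀ k, S.x (k + 1) = S.xh k + (A.τ k / t0) • (S.xt (k + 1) - S.xt k)
  yh_succ : ∀ k, S.yh (k + 1) =
    (A.η k * (1 - A.τ k) / A.ρ (k - 1)) • S.yh (k - 1)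
      + (1 - A.η k / A.ρ k) • S.yh k
      + (A.η k / A.ρ k) • S.y (k + 1)
      + A.η k • Q.K (S.x (k + 1) - S.xh k - (1 - A.τ k) • (S.x k - S.xh (k - 1)))
      - (A.η k * (1 - A.τ k) / A.ρ (k - 1)) • S.y k
  yb_succ : ∀ k, S.yb (k + 1) = (1 - A.τ k) • S.yb k + A.τ k • S.y (k + 1)

/-- The constant
`Ē₀² = F(x⁰) - F* + (τ₀ (L^h_σ + 2 L̄_σ ρ₀ + μ^f_σ) / 2) ‖x⁰ - x*‖²_{σ/q} + (1/ρ₀) ‖ŷ⁰ - y*‖²`. -/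
def E0sq {n m : ℕ} {p : Fin n → ℕ} {d : Fin m → ℕ} (Q : Problem n m p d)
    (μ L σ q : Fin n → ℝ) (t0 ρ0 : ℝ) (x0 xs : BlockSpace p) (yh0 ys : BlockSpace d) : ℝ :=
  ((Q.F x0).toReal - Q.Fstar.toReal)
    + t0 * (Lh L σ + 2 * Q.Lbar σ * ρ0 + muF μ σ) / 2 * wnormSq (fun j => σ j / q j) (x0 - xs)
    + 1 / ρ0 * ‖yh0 - ys‖ ^ 2

/-- `u_k = o(v_k)` in the sense `liminf_k u_k / v_k = 0`, the lower limit being taken in the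
extended reals. -/
def IsLiminfLittleO (u v : ℕ → ℝ) : Prop :=
  liminf (fun k => ((u k / v k : ℝ) : EReal)) atTop = 0

end SemiRandPD

end

/-!
By Moreau's identity the update of `y` is a proximal step for `g`: it makes `y (k + 1)` a
subgradient of `g` at a point `r (k + 1)`, so the scheme is an augmented Lagrangian method for the
relaxed constraint `K x = r`. Its energy is the Lagrangian gap at `(x k, r k)`, with `f (x k)`
replaced by the averages of the `f (x̃ l)` that dominate it, plus a weighted squared residual
`‖K (x k) - r k‖²`. Strong convexity and the step-size condition make the energy times a quadratic
scale, plus two distance terms, decrease in conditional expectation over the drawn block, by a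
fixed multiple of the scale increment times the energy. Hence the expected energy is `O(1 / k²)`
and the expected energies weighted by `k` are summable. Lipschitz continuity of `g` bounds
`F (x k) - F⋆` by the energy plus `(M_g + ‖y⋆‖)` times the residual, which is a square root of the
energy over `k`. Jensen's inequality then yields the rate, and the divergence of `∑ 1 / (k log k)`
yields the lower limit.
-/

noncomputable section

namespace SemiRandPD

/-! ### Convex analysis -/

section ConvexAnalysis

variable {E : Type*} [NormedAddCommGroup E] [InnerProductSpace ℝ E]

lemma norm_combo_sq (u v : E) {a b : ℝ} (hab : a + b = 1) :
    ‖a • u + b • v‖ ^ 2 = a * ‖u‖ ^ 2 + b * ‖v‖ ^ 2 - a * b * ‖u - v‖ ^ 2 := by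
  rw [norm_add_sq_real, norm_sub_sq_real, norm_smul, norm_smul, real_inner_smul_left,
    real_inner_smul_right, Real.norm_eq_abs, Real.norm_eq_abs, mul_pow, mul_pow, sq_abs, sq_abs]
  obtain rfl : b = 1 - a := by linarith
  ring

/-- The effective domain of an extended-real-valued function. -/
def effDom (f : E → EReal) : Set E := {x | f x ≠ ⊤}

lemma toReal_le_of_le_coe {a : EReal} {r : ℝ} (h : a ≤ (r : EReal)) (hb : a ≠ ⊥) :
    a.toReal ≤ r := by
  simpa only [EReal.toReal_coe] using EReal.toReal_le_toReal h hb (EReal.coe_ne_top r)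

lemma IsConvexFun.convexOn_toReal {f : E → EReal} (hf : IsConvexFun f) (hbot : ∀ x, f x ≠ ⊥) :
    ConvexOn ℝ (effDom f) fun x => (f x).toReal := by
  have le_combo {x y : E} (hx : x ∈ effDom f) (hy : y ∈ effDom f) {a b : ℝ} (ha : 0 ≤ a)
      (hb : 0 ≤ b) (hab : a + b = 1) :
      f (a • x + b • y) ≤ ((a * (f x).toReal + b * (f y).toReal : ℝ) : EReal) := by
    have hx' : (x, (f x).toReal) ∈ {z : E × ℝ | f z.1 ≤ (z.2 : EReal)} := EReal.le_coe_toReal hx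
    have hy' : (y, (f y).toReal) ∈ {z : E × ℝ | f z.1 ≤ (z.2 : EReal)} := EReal.le_coe_toReal hy
    simpa using! hf hx' hy' ha hb hab
  exact ⟨fun x hx y hy a b ha hb hab =>
      ((le_combo hx hy ha hb hab).trans_lt (EReal.coe_lt_top _)).ne,
    fun x hx y hy a b ha hb hab => toReal_le_of_le_coe (le_combo hx hy ha hb hab) (hbot _)⟩

lemma IsStronglyConvexFun.strongConvexOn_toReal {f : E → EReal} {μ : ℝ}
    (hf : IsStronglyConvexFun μ f) (hbot : ∀ x, f x ≠ ⊥) :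
    StrongConvexOn (effDom f) μ fun x => (f x).toReal := by
  have sub_eq {x : E} (r : ℝ) (hx : f x ≠ ⊤) :
      f x - (r : EReal) = (((f x).toReal - r : ℝ) : EReal) := by
    rw [EReal.coe_sub, EReal.coe_toReal hx (hbot x)]
  have hdom : effDom (fun x => f x - ((μ / 2 * ‖x‖ ^ 2 : ℝ) : EReal)) = effDom f := by
    ext x
    refine not_congr ⟨fun h => ?_, fun h => ?_⟩
    · by_contra hx
      exact EReal.coe_ne_top _ ((sub_eq _ hx).symm.trans h)
    · simp only [h, EReal.top_sub_coe]
  have h := hf.convexOn_toReal fun x => by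
    by_cases hx : f x = ⊤
    · simp only [hx, EReal.top_sub_coe, ne_eq, top_ne_bot, not_false_eq_true]
    · simp only [sub_eq _ hx]; exact EReal.coe_ne_bot _
  rw [hdom] at h
  rw [strongConvexOn_iff_convex]
  exact h.congr fun x hx => by simp only [sub_eq _ hx, EReal.toReal_coe]

lemma add_norm_sq_le_of_strongConvexOn {s : Set E} {m : ℝ} {ψ : E → ℝ}
    (hψ : StrongConvexOn s m ψ) {u v : E} (hu : u ∈ s) (hv : v ∈ s) (hmin : ∀ w ∈ s, ψ u ≤ ψ w) :
    ψ u + m / 2 * ‖u - v‖ ^ 2 ≤ ψ v := by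
  have le_of_mem : ∀ t ∈ Set.Ioo (0 : ℝ) 1, ψ u + (1 - t) * (m / 2 * ‖u - v‖ ^ 2) ≤ ψ v := by
    intro t ht
    have hconv := hψ.2 hu hv (sub_nonneg.2 ht.2.le) ht.1.le (by ring)
    have hle := hmin _ (hψ.1 hu hv (sub_nonneg.2 ht.2.le) ht.1.le (by ring))
    simp only [smul_eq_mul] at hconv
    exact le_of_mul_le_mul_left (by nlinarith) ht.1
  have hlim : Tendsto (fun t : ℝ => ψ u + (1 - t) * (m / 2 * ‖u - v‖ ^ 2)) (𝓝[>] 0)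
      (𝓝 (ψ u + (1 - 0) * (m / 2 * ‖u - v‖ ^ 2))) :=
    tendsto_nhdsWithin_of_tendsto_nhds (Continuous.tendsto (by fun_prop) 0)
  have := le_of_tendsto hlim (eventually_of_mem (Ioo_mem_nhdsGT zero_lt_one) le_of_mem)
  simpa only [sub_zero, one_mul] using this

lemma strongConvexOn_prox_objective {s : Set E} {m γ : ℝ} {ψ : E → ℝ} (hγ : 0 < γ)
    (hψ : StrongConvexOn s m ψ) (z : E) :
    StrongConvexOn s (1 + γ * m) fun v => γ * ψ v + ‖v - z‖ ^ 2 / 2 := by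
  refine ⟨hψ.1, fun x hx y hy a b ha hb hab => ?_⟩
  have hψab := mul_le_mul_of_nonneg_left (hψ.2 hx hy ha hb hab) hγ.le
  have hsq := norm_combo_sq (x - z) (y - z) hab
  have hz : a • (x - z) + b • (y - z) = a • x + b • y - z := by
    rw [smul_sub, smul_sub, sub_add_sub_comm, ← add_smul, hab, one_smul]
  rw [hz, sub_sub_sub_cancel_right] at hsq
  simp only [smul_eq_mul] at hψab ⊢
  rw [hsq]
  linarith

namespace IsProx

variable {γ μ : ℝ} {f : E → EReal} {z u : E}

omit [InnerProductSpace ℝ E] in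
lemma mem_effDom (h : IsProx γ f z u) (hγ : 0 < γ) (hbot : ∀ x, f x ≠ ⊥) {v : E}
    (hv : v ∈ effDom f) : u ∈ effDom f := by
  intro hu
  have huv := h v
  rw [hu, EReal.coe_mul_top_of_pos hγ, EReal.top_add_coe, ← EReal.coe_toReal hv (hbot v),
    ← EReal.coe_mul, ← EReal.coe_add] at huv
  exact EReal.coe_ne_top _ (top_le_iff.1 huv)

lemma three_point (h : IsProx γ f z u) (hγ : 0 < γ) (hbot : ∀ x, f x ≠ ⊥)
    (hf : StrongConvexOn (effDom f) μ fun x => (f x).toReal) {v : E} (hv : v ∈ effDom f) :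
    γ * (f u).toReal + ‖u - z‖ ^ 2 / 2 + (1 + γ * μ) / 2 * ‖u - v‖ ^ 2
      ≤ γ * (f v).toReal + ‖v - z‖ ^ 2 / 2 := by
  have hu := h.mem_effDom hγ hbot hv
  refine add_norm_sq_le_of_strongConvexOn (strongConvexOn_prox_objective hγ hf z) hu hv
    fun w hw => ?_
  have huw := h w
  rw [← EReal.coe_toReal hu (hbot u), ← EReal.coe_toReal hw (hbot w)] at huw
  exact_mod_cast huw

lemma unique (h : IsProx γ f z u) (hγ : 0 < γ) (hbot : ∀ x, f x ≠ ⊥)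
    (hne : (effDom f).Nonempty) (hμ : 0 ≤ μ)
    (hf : StrongConvexOn (effDom f) μ fun x => (f x).toReal) {u' : E} (h' : IsProx γ f z u') :
    u = u' := by
  obtain ⟨v, hv⟩ := hne
  have huu' := h.three_point hγ hbot hf (h'.mem_effDom hγ hbot hv)
  have hu'u := h'.three_point hγ hbot hf (h.mem_effDom hγ hbot hv)
  rw [norm_sub_rev u' u] at hu'u
  have hsq : ‖u - u'‖ ^ 2 ≤ 0 := by
    have : 0 ≤ γ * μ * ‖u - u'‖ ^ 2 := by positivity
    linarith
  exact sub_eq_zero.1 (norm_eq_zero.1 (pow_eq_zero_iff two_ne_zero |>.1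
    (hsq.antisymm (sq_nonneg _))))

end IsProx

section Duality

variable {H : Type*} [NormedAddCommGroup H] [InnerProductSpace ℝ H]

/-- The strict epigraph of the value function `u ↦ inf_{x ∈ D} φ x + g (K x + u)` of the perturbed
problem. -/
def perturbedEpigraph (D : Set E) (φ : E → ℝ) (g : H → ℝ) (K : E →L[ℝ] H) : Set (H × ℝ) :=
  {z | ∃ x ∈ D, φ x + g (K x + z.1) < z.2}

lemma convex_perturbedEpigraph {D : Set E} {φ : E → ℝ} {g : H → ℝ} (hφ : ConvexOn ℝ D φ)
    (hg : ConvexOn ℝ Set.univ g) (K : E →L[ℝ] H) : Convex ℝ (perturbedEpigraph D φ g K) := by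
  have hsum : ConvexOn ℝ (LinearMap.fst ℝ E H ⁻¹' D) fun w => φ w.1 + g (K w.1 + w.2) :=
    (hφ.comp_linearMap (.fst ℝ E H)).add ((hg.comp_linearMap (K.toLinearMap.coprod .id)).subset
      (Set.subset_univ _) (hφ.comp_linearMap (.fst ℝ E H)).1)
  have himage : (LinearMap.snd ℝ E H).prodMap (.id : ℝ →ₗ[ℝ] ℝ) ''
      {w | w.1 ∈ LinearMap.fst ℝ E H ⁻¹' D ∧ φ w.1.1 + g (K w.1.1 + w.1.2) < w.2} =
      perturbedEpigraph D φ g K := by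
    ext ⟨u, t⟩
    simp [perturbedEpigraph]
  exact himage ▸ hsum.convex_strict_epigraph.linear_image _

lemma isOpen_perturbedEpigraph (D : Set E) (φ : E → ℝ) {g : H → ℝ} (hg : Continuous g)
    (K : E →L[ℝ] H) : IsOpen (perturbedEpigraph D φ g K) := by
  have : perturbedEpigraph D φ g K = ⋃ x ∈ D, {z | φ x + g (K x + z.1) < z.2} := by
    ext z; simp [perturbedEpigraph]
  rw [this]
  exact isOpen_biUnion fun x _ => isOpen_lt (by fun_prop) (by fun_prop)

variable [CompleteSpace H]

lemma exists_affine_minorant_of_isOpen {C : Set (H × ℝ)} (hCc : Convex ℝ C) (hCo : IsOpen C)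
    {a b : ℝ} (ha : (0, a) ∉ C) (hab : a < b) (hb : (0, b) ∈ C) :
    ∃ y : H, ∀ z ∈ C, a + inner ℝ y z.1 < z.2 := by
  obtain ⟨ℓ, hℓ⟩ := geometric_hahn_banach_open_point hCc hCo ha
  set s := ℓ (0, 1) with hs
  have ℓ_eq (u : H) (t : ℝ) : ℓ (u, t) = ℓ (u, 0) + t * s := by
    rw [← smul_eq_mul, hs, ← map_smul, ← map_add]
    simp
  have ℓ_zero : ℓ (0, 0) = 0 := map_zero ℓ
  have hsneg : s < 0 := by
    have := hℓ _ hb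
    rw [ℓ_eq 0 a, ℓ_eq 0 b] at this
    nlinarith
  refine ⟨(-s)⁻¹ • (InnerProductSpace.toDual ℝ H).symm (ℓ.comp (.inl ℝ H ℝ)), fun z hz => ?_⟩
  have hlt := hℓ z hz
  rw [← Prod.mk.eta (p := z), ℓ_eq z.1, ℓ_eq 0 a, ℓ_zero] at hlt
  have : (-s)⁻¹ * ℓ (z.1, 0) < z.2 - a := by
    rw [inv_mul_lt_iff₀ (neg_pos.2 hsneg)]
    linarith
  rw [real_inner_smul_left, InnerProductSpace.toDual_symm_apply]
  change a + (-s)⁻¹ * ℓ (z.1, 0) < z.2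
  linarith

lemma exists_multiplier {D : Set E} {φ : E → ℝ} {g : H → ℝ} (K : E →L[ℝ] H)
    (hφ : ConvexOn ℝ D φ) (hg : ConvexOn ℝ Set.univ g) (hgc : Continuous g) {xs : E}
    (hxs : xs ∈ D) (hmin : ∀ x ∈ D, φ xs + g (K xs) ≤ φ x + g (K x)) :
    ∃ y : H, ∀ x ∈ D, ∀ u : H, φ xs + g (K xs) + inner ℝ y u ≤ φ x + g (K x + u) := by
  have hbelow : (0, φ xs + g (K xs)) ∉ perturbedEpigraph D φ g K := by
    rintro ⟨x, hx, h⟩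
    exact (hmin x hx).not_gt (by simpa using h)
  obtain ⟨y, hy⟩ := exists_affine_minorant_of_isOpen (convex_perturbedEpigraph hφ hg K)
    (isOpen_perturbedEpigraph D φ hgc K) hbelow (lt_add_one _) ⟨xs, hxs, by simp⟩
  exact ⟨y, fun x hx u => le_of_forall_gt_imp_ge_of_dense fun t ht => (hy (u, t) ⟨x, hx, ht⟩).le⟩

lemma exists_subgradient {g : H → ℝ} (hg : ConvexOn ℝ Set.univ g) (hgc : Continuous g) (r : H) :
    ∃ y : H, ∀ s, g r + inner ℝ y (s - r) ≤ g s := by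
  obtain ⟨y, hy⟩ := exists_multiplier (D := {r}) (φ := 0) (.id ℝ H)
    (convexOn_const 0 (convex_singleton r)) hg hgc rfl (by rintro x rfl; exact le_rfl)
  exact ⟨y, fun s => by simpa using hy r rfl (s - r)⟩

end Duality

section Conjugate

variable {g : E → ℝ}

lemma coe_le_conjugate (g : E → ℝ) (y s : E) :
    ((inner ℝ y s - g s : ℝ) : EReal) ≤ conjugate (fun x => (g x : EReal)) y := by
  rw [EReal.coe_sub]
  exact le_iSup (fun x => ((inner ℝ y x : ℝ) : EReal) - (g x : EReal)) s

lemma conjugate_ne_bot (g : E → ℝ) (y : E) : conjugate (fun x => (g x : EReal)) y ≠ ⊥ :=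
  ((EReal.bot_lt_coe _).trans_le (coe_le_conjugate g y 0)).ne'

lemma conjugate_le_coe_iff {y : E} {a : ℝ} :
    conjugate (fun x => (g x : EReal)) y ≤ (a : EReal) ↔ ∀ s, inner ℝ y s - g s ≤ a := by
  simp only [conjugate, iSup_le_iff]
  exact forall_congr' fun s => by norm_cast

lemma sub_le_toReal_conjugate {y : E} (hy : y ∈ effDom (conjugate fun x => (g x : EReal))) (s : E) :
    inner ℝ y s - g s ≤ (conjugate (fun x => (g x : EReal)) y).toReal :=
  conjugate_le_coe_iff.1 (EReal.le_coe_toReal hy) s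

lemma isConvexFun_conjugate (g : E → ℝ) : IsConvexFun (conjugate fun x => (g x : EReal)) := by
  have : {z : E × ℝ | conjugate (fun x => (g x : EReal)) z.1 ≤ z.2} =
      ⋂ s, {z : E × ℝ | ((innerₗ E).flip s ∘ₗ .fst ℝ E ℝ - .snd ℝ E ℝ) z ≤ g s} := by
    ext z
    simp only [Set.mem_ofPred_eq, conjugate_le_coe_iff, Set.mem_iInter]
    exact forall_congr' fun s => sub_le_comm
  rw [IsConvexFun, this]
  exact convex_iInter fun s => convex_halfSpace_le (LinearMap.isLinear _) _

lemma convexOn_toReal_conjugate (g : E → ℝ) :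
    ConvexOn ℝ (effDom (conjugate fun x => (g x : EReal)))
      fun y => (conjugate (fun x => (g x : EReal)) y).toReal :=
  (isConvexFun_conjugate g).convexOn_toReal (conjugate_ne_bot g)

lemma conjugate_le_of_subgradient {y r : E} (hy : ∀ s, g r + inner ℝ y (s - r) ≤ g s) :
    conjugate (fun x => (g x : EReal)) y ≤ ((inner ℝ y r - g r : ℝ) : EReal) := by
  refine conjugate_le_coe_iff.2 fun s => ?_
  have := hy s
  rw [inner_sub_right] at this
  linarith

lemma mem_effDom_conjugate_of_subgradient {y r : E}
    (hy : ∀ s, g r + inner ℝ y (s - r) ≤ g s) :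
    y ∈ effDom (conjugate fun x => (g x : EReal)) :=
  ((conjugate_le_of_subgradient hy).trans_lt (EReal.coe_lt_top _)).ne

variable [CompleteSpace E]

/-- Moreau's identity: `prox_{ρ g*}(z)` is a subgradient of `g` at `(z - prox_{ρ g*}(z)) / ρ`. -/
lemma IsProx.subgradient_of_conjugate (hg : ConvexOn ℝ Set.univ g) (hgc : Continuous g) {ρ : ℝ}
    (hρ : 0 < ρ) {u r : E} (h : IsProx ρ (conjugate fun x => (g x : EReal)) (u + ρ • r) u)
    (s : E) : g r + inner ℝ u (s - r) ≤ g s := by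
  obtain ⟨y, hy⟩ := exists_subgradient hg hgc r
  have hyd := mem_effDom_conjugate_of_subgradient hy
  have hyr := toReal_le_of_le_coe (conjugate_le_of_subgradient hy) (conjugate_ne_bot g y)
  have hprox := h.three_point hρ (conjugate_ne_bot g)
    (strongConvexOn_zero.2 (convexOn_toReal_conjugate g)) hyd
  have hu : u - (u + ρ • r) = -(ρ • r) := by abel
  have hyu : y - (u + ρ • r) = (y - u) - ρ • r := by abel
  rw [hyu, hu, norm_neg, norm_sub_sq_real (y - u),
    norm_sub_rev u y, real_inner_smul_right, inner_sub_left] at hprox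
  have huconj : (conjugate (fun x => (g x : EReal)) u).toReal ≤ inner ℝ u r - g r :=
    le_of_mul_le_mul_left (by nlinarith) hρ
  have := sub_le_toReal_conjugate (h.mem_effDom hρ (conjugate_ne_bot g) hyd) s
  rw [inner_sub_right]
  linarith

lemma IsProx.unique_of_conjugate (hg : ConvexOn ℝ Set.univ g) (hgc : Continuous g) {ρ : ℝ}
    (hρ : 0 < ρ) {z u u' : E} (h : IsProx ρ (conjugate fun x => (g x : EReal)) z u)
    (h' : IsProx ρ (conjugate fun x => (g x : EReal)) z u') : u = u' := by
  obtain ⟨y, hy⟩ := exists_subgradient hg hgc 0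
  exact h.unique hρ (conjugate_ne_bot g) ⟨y, mem_effDom_conjugate_of_subgradient hy⟩ le_rfl
    (strongConvexOn_zero.2 (convexOn_toReal_conjugate g)) h'

end Conjugate

end ConvexAnalysis


/-! ### The composite problem -/

lemma ereal_sum_ne_bot {ι : Type*} (s : Finset ι) {a : ι → EReal} (ha : ∀ i, a i ≠ ⊥) :
    ∑ i ∈ s, a i ≠ ⊥ := by
  induction s using Finset.cons_induction with
  | empty => simp
  | cons i s hi ih =>
    rw [Finset.sum_cons, Ne, EReal.add_eq_bot_iff]
    exact not_or.2 ⟨ha i, ih⟩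

lemma ereal_sum_eq_top {ι : Type*} {s : Finset ι} {a : ι → EReal} (ha : ∀ i, a i ≠ ⊥) {i : ι}
    (hi : i ∈ s) (h : a i = ⊤) : ∑ i ∈ s, a i = ⊤ := by
  classical
  rw [← Finset.add_sum_erase s a hi, h, EReal.top_add_of_ne_bot (ereal_sum_ne_bot _ ha)]

lemma ereal_sum_eq_coe {ι : Type*} (s : Finset ι) {a : ι → EReal} (hbot : ∀ i, a i ≠ ⊥)
    (htop : ∀ i, a i ≠ ⊤) : ∑ i ∈ s, a i = ((∑ i ∈ s, (a i).toReal : ℝ) : EReal) := by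
  induction s using Finset.cons_induction with
  | empty => simp
  | cons i s hi ih =>
    rw [Finset.sum_cons, Finset.sum_cons, ih, EReal.coe_add, EReal.coe_toReal (htop i) (hbot i)]

section Smooth

variable {E : Type*} [NormedAddCommGroup E] [InnerProductSpace ℝ E] [CompleteSpace E] {h : E → ℝ}

lemma hasDerivAt_comp_add_smul (hd : Differentiable ℝ h) (x v : E) (s : ℝ) :
    HasDerivAt (fun s : ℝ => h (x + s • v)) (inner ℝ (gradient h (x + s • v)) v) s := by
  have hline : HasDerivAt (fun s : ℝ => x + s • v) v s := by
    simpa using ((hasDerivAt_id s).smul_const v).const_add x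
  rw [inner_gradient_left]
  exact (hd (x + s • v)).hasFDerivAt.comp_hasDerivAt s hline

lemma add_inner_gradient_le (hc : ConvexOn ℝ Set.univ h) (hd : Differentiable ℝ h) (x y : E) :
    h x + inner ℝ (gradient h x) (y - x) ≤ h y := by
  have hconv : ConvexOn ℝ Set.univ (fun s : ℝ => h (x + s • (y - x))) := by
    simpa [Function.comp_def, AffineMap.lineMap_apply, add_comm] using
      hc.comp_affineMap (AffineMap.lineMap x y : ℝ →ᵃ[ℝ] E)
  have hslope := hconv.le_slope_of_hasDerivAt (Set.mem_univ 0) (Set.mem_univ 1) zero_lt_one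
    (hasDerivAt_comp_add_smul hd x (y - x) 0)
  simp only [slope_def_field, one_smul, zero_smul, add_zero, sub_zero, div_one,
    add_sub_cancel] at hslope
  linarith

lemma descent_along (hd : Differentiable ℝ h) {x v : E} {C : ℝ}
    (hC : ∀ s : ℝ, 0 ≤ s → inner ℝ (gradient h (x + s • v) - gradient h x) v ≤ s * C) :
    h (x + v) ≤ h x + inner ℝ (gradient h x) v + C / 2 := by
  set ψ : ℝ → ℝ := fun s => h (x + s • v) - s * inner ℝ (gradient h x) v - s ^ 2 * (C / 2)
  have hder (s : ℝ) : HasDerivAt ψ (inner ℝ (gradient h (x + s • v)) v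
      - 1 * inner ℝ (gradient h x) v - (2 * s) * (C / 2)) s :=
    ((hasDerivAt_comp_add_smul hd x v s).sub ((hasDerivAt_id s).mul_const _)).sub
      (by simpa using (hasDerivAt_pow 2 s).mul_const (C / 2))
  have hanti : AntitoneOn ψ (Set.Icc 0 1) := by
    refine antitoneOn_of_deriv_nonpos (convex_Icc 0 1)
      (fun s _ => (hder s).continuousAt.continuousWithinAt)
      (fun s _ => (hder s).differentiableAt.differentiableWithinAt) fun s hs => ?_
    rw [interior_Icc] at hs
    have := hC s hs.1.le
    rw [inner_sub_left] at this
    rw [(hder s).deriv]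
    linarith
  have := hanti (Set.left_mem_Icc.2 zero_le_one) (Set.right_mem_Icc.2 zero_le_one) zero_le_one
  simp only [ψ, one_smul, zero_smul, add_zero] at this
  linarith

end Smooth

section Blocks

variable {n m : ℕ} {p : Fin n → ℕ} {d : Fin m → ℕ}

@[simp] lemma blockEmbed_same (j : Fin n) (t : EuclideanSpace ℝ (Fin (p j))) :
    blockEmbed j t j = t := by
  simp [blockEmbed]

lemma blockEmbed_ne {i j : Fin n} (h : i ≠ j) (t : EuclideanSpace ℝ (Fin (p j))) :
    blockEmbed j t i = 0 := by
  simp [blockEmbed, Pi.single_eq_of_ne h]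

lemma blockEmbed_smul (j : Fin n) (a : ℝ) (t : EuclideanSpace ℝ (Fin (p j))) :
    blockEmbed j (a • t) = a • blockEmbed j t := by
  simp [blockEmbed, Pi.single_smul]

lemma inner_blockEmbed (x : BlockSpace p) (j : Fin n) (t : EuclideanSpace ℝ (Fin (p j))) :
    inner ℝ x (blockEmbed j t) = inner ℝ (x j) t := by
  rw [PiLp.inner_apply, Finset.sum_eq_single j _ (by simp), blockEmbed_same]
  intro i _ hi
  rw [blockEmbed_ne hi, inner_zero_right]

lemma norm_blockEmbed (j : Fin n) (t : EuclideanSpace ℝ (Fin (p j))) :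
    ‖(blockEmbed j t : BlockSpace p)‖ = ‖t‖ := by
  rw [← sq_eq_sq₀ (norm_nonneg _) (norm_nonneg _), ← real_inner_self_eq_norm_sq, inner_blockEmbed,
    blockEmbed_same, real_inner_self_eq_norm_sq]

lemma sub_eq_blockEmbed {x y : BlockSpace p} {j : Fin n} (h : ∀ i, i ≠ j → x i = y i) :
    x - y = blockEmbed j (x j - y j) := by
  ext i : 1
  by_cases hi : i = j
  · subst hi; simp
  · simp [blockEmbed_ne hi, h i hi]

lemma blockDiag_blockEmbed (w : Fin n → ℝ) (j : Fin n) (t : EuclideanSpace ℝ (Fin (p j))) :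
    blockDiag p w (blockEmbed j t) = blockEmbed j (w j • t) := by
  ext i : 1
  change w i • blockEmbed j t i = _
  by_cases h : i = j
  · subst h; simp
  · simp [blockEmbed_ne h]

lemma Problem.norm_sq_K_blockEmbed_le (Q : Problem n m p d) {σ : Fin n → ℝ} (hσ : ∀ j, 0 < σ j)
    (j : Fin n) (t : EuclideanSpace ℝ (Fin (p j))) :
    ‖Q.K (blockEmbed j t)‖ ^ 2 ≤ Q.Lbar σ * (σ j * ‖t‖ ^ 2) := by
  have hs := Real.sqrt_pos.2 (hσ j)
  set KD := Q.K.comp (blockDiag p fun j => 1 / √(σ j)) with hKD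
  have hK : Q.K (blockEmbed j t) = KD (blockEmbed j (√(σ j) • t)) := by
    rw [hKD, ContinuousLinearMap.comp_apply, blockDiag_blockEmbed, smul_smul,
      one_div_mul_cancel hs.ne', one_smul]
  calc ‖Q.K (blockEmbed j t)‖ ^ 2
      ≤ (‖KD‖ * ‖(blockEmbed j (√(σ j) • t) : BlockSpace p)‖) ^ 2 := by
        rw [hK]
        gcongr
        exact KD.le_opNorm _
    _ = Q.Lbar σ * (σ j * ‖t‖ ^ 2) := by
        rw [norm_blockEmbed, norm_smul, Real.norm_of_nonneg hs.le, mul_pow, mul_pow,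
          Real.sq_sqrt (hσ j).le, Problem.Lbar]

lemma block_descent {h : BlockSpace p → ℝ} (hd : Differentiable ℝ h) {L : ℝ} {j : Fin n}
    (hL : ∀ (x : BlockSpace p) (t : EuclideanSpace ℝ (Fin (p j))),
      ‖gradient h (x + blockEmbed j t) j - gradient h x j‖ ≤ L * ‖t‖)
    (x : BlockSpace p) (t : EuclideanSpace ℝ (Fin (p j))) :
    h (x + blockEmbed j t) ≤ h x + inner ℝ (gradient h x j) t + L / 2 * ‖t‖ ^ 2 := by
  have h_descent := descent_along hd (x := x) (v := blockEmbed j t) (C := L * ‖t‖ ^ 2)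
    fun s hs => ?_
  · rw [inner_blockEmbed] at h_descent
    linarith
  · rw [inner_blockEmbed, ← blockEmbed_smul]
    calc _ ≤ ‖gradient h (x + blockEmbed j (s • t)) j - gradient h x j‖ * ‖t‖ :=
          real_inner_le_norm _ _
      _ ≤ L * ‖s • t‖ * ‖t‖ := by gcongr; exact hL x (s • t)
      _ = s * (L * ‖t‖ ^ 2) := by rw [norm_smul, Real.norm_of_nonneg hs]; ring

end Blocks

namespace Problem

variable {n m : ℕ} {p : Fin n → ℕ} {d : Fin m → ℕ} (Q : Problem n m p d)

/-- The effective domain of `f`, which is also that of the objective `F`. -/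
def dom : Set (BlockSpace p) := {x | ∀ j, x j ∈ effDom (Q.fj j)}

/-- The real value of `f`, meaningful on `Q.dom` only. -/
def fR (x : BlockSpace p) : ℝ := ∑ j, (Q.fj j (x j)).toReal

/-- The real value of `g`, meaningful where `g` is finite. -/
def gR (y : BlockSpace d) : ℝ := (Q.g y).toReal

/-- The real value of the objective `F`, meaningful on `Q.dom` only. -/
def FR (x : BlockSpace p) : ℝ := Q.fR x + Q.h x + Q.gR (Q.K x)

/-- `y` is a Lagrange multiplier of the constraint `K x = r` in the problem of minimizing
`f(x) + h(x) + g(r)`, whose optimal value is `F(xs)`. -/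
def IsMultiplier (xs : BlockSpace p) (y : BlockSpace d) : Prop :=
  ∀ x ∈ Q.dom, ∀ r, Q.FR xs ≤ Q.fR x + Q.h x + Q.gR r + inner ℝ y (Q.K x - r)

variable {Q} {μ L : Fin n → ℝ}

namespace Assumptions

variable (hQ : Q.Assumptions μ L) {Mg : ℝ} (hg : IsLipschitzFun Mg Q.g)
include hQ

lemma strongConvexOn_fj (j : Fin n) :
    StrongConvexOn (effDom (Q.fj j)) (μ j) fun z => (Q.fj j z).toReal :=
  (hQ.fj_strong j).strongConvexOn_toReal (hQ.fj_proper j).1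

lemma f_eq_coe {x : BlockSpace p} (hx : x ∈ Q.dom) : Q.f x = (Q.fR x : EReal) :=
  ereal_sum_eq_coe _ (fun j => (hQ.fj_proper j).1 _) hx

lemma f_eq_top {x : BlockSpace p} (hx : x ∉ Q.dom) : Q.f x = ⊤ := by
  obtain ⟨j, hj⟩ := not_forall.1 hx
  exact ereal_sum_eq_top (fun i => (hQ.fj_proper i).1 _) (Finset.mem_univ j) (not_not.1 hj)

lemma convexOn_fR : ConvexOn ℝ Q.dom Q.fR := by
  have hj (j : Fin n) := strongConvexOn_zero.1 ((hQ.strongConvexOn_fj j).mono (hQ.μ_pos j).le)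
  refine ⟨fun x hx y hy a b ha hb hab j => (hj j).1 (hx j) (hy j) ha hb hab,
    fun x hx y hy a b ha hb hab => ?_⟩
  simp only [fR, smul_eq_mul, Finset.mul_sum, ← Finset.sum_add_distrib]
  exact Finset.sum_le_sum fun j _ => (hj j).2 (hx j) (hy j) ha hb hab

include hg

lemma g_ne_top (y : BlockSpace d) : Q.g y ≠ ⊤ := by
  choose z hz using fun i => (hQ.gi_proper i).2
  have hgz : Q.g (WithLp.toLp 2 z) = ((∑ i, (Q.gi i (z i)).toReal : ℝ) : EReal) :=
    ereal_sum_eq_coe _ (fun i => (hQ.gi_proper i).1 _) hz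
  have hle := hg.2 y (WithLp.toLp 2 z)
  rw [hgz, ← EReal.coe_add] at hle
  exact (hle.trans_lt (EReal.coe_lt_top _)).ne

lemma g_eq_coe (y : BlockSpace d) : Q.g y = (Q.gR y : EReal) :=
  (EReal.coe_toReal (hQ.g_ne_top hg y)
    (ereal_sum_ne_bot _ fun i => (hQ.gi_proper i).1 _)).symm

lemma g_eq : Q.g = fun y => (Q.gR y : EReal) := funext (hQ.g_eq_coe hg)

lemma gR_le_add (x y : BlockSpace d) : Q.gR x ≤ Q.gR y + Mg * ‖x - y‖ := by
  have h := hg.2 x y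
  rw [hQ.g_eq_coe hg, hQ.g_eq_coe hg, ← EReal.coe_add] at h
  exact_mod_cast h

lemma continuous_gR : Continuous Q.gR := by
  refine (LipschitzWith.of_le_add_mul (Real.toNNReal Mg) fun x y => ?_).continuous
  rw [Real.coe_toNNReal _ hg.1, dist_eq_norm]
  exact hQ.gR_le_add hg x y

lemma convexOn_gR : ConvexOn ℝ Set.univ Q.gR := by
  have gi_ne_top (y : BlockSpace d) (i : Fin m) : Q.gi i (y i) ≠ ⊤ := fun hi =>
    hQ.g_ne_top hg y (ereal_sum_eq_top (fun i => (hQ.gi_proper i).1 _) (Finset.mem_univ i) hi)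
  have gR_eq (y : BlockSpace d) : Q.gR y = ∑ i, (Q.gi i (y i)).toReal := by
    rw [← EReal.coe_eq_coe_iff, ← hQ.g_eq_coe hg]
    exact ereal_sum_eq_coe _ (fun i => (hQ.gi_proper i).1 _) (gi_ne_top y)
  have hi (i : Fin m) := (hQ.gi_convex i).convexOn_toReal (hQ.gi_proper i).1
  refine ⟨convex_univ, fun x _ y _ a b ha hb hab => ?_⟩
  simp only [gR_eq, smul_eq_mul, Finset.mul_sum, ← Finset.sum_add_distrib]
  exact Finset.sum_le_sum fun i _ => (hi i).2 (gi_ne_top x i) (gi_ne_top y i) ha hb hab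

lemma F_eq_coe {x : BlockSpace p} (hx : x ∈ Q.dom) : Q.F x = (Q.FR x : EReal) := by
  rw [F, phi, hQ.f_eq_coe hx, hQ.g_eq_coe hg]
  rfl

lemma F_ne_top_iff {x : BlockSpace p} : Q.F x ≠ ⊤ ↔ x ∈ Q.dom := by
  refine ⟨fun h => by_contra fun hx => h ?_, fun hx => ?_⟩
  · rw [F, phi, hQ.f_eq_top hx, hQ.g_eq_coe hg, EReal.top_add_coe, EReal.top_add_coe]
  · rw [hQ.F_eq_coe hg hx]
    exact EReal.coe_ne_top _

end Assumptions

namespace IsPrimalSolution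

variable {xs x : BlockSpace p} (hxs : Q.IsPrimalSolution xs) (hQ : Q.Assumptions μ L) {Mg : ℝ}
  (hg : IsLipschitzFun Mg Q.g) (hx : x ∈ Q.dom)
include hxs hQ hg hx

lemma mem_dom : xs ∈ Q.dom := by
  rw [← hQ.F_ne_top_iff hg]
  exact ((hxs x).trans_lt ((hQ.F_ne_top_iff hg).2 hx).lt_top).ne

lemma FR_le : Q.FR xs ≤ Q.FR x := by
  have h := hxs x
  rw [hQ.F_eq_coe hg hx, hQ.F_eq_coe hg (hxs.mem_dom hQ hg hx)] at h
  exact_mod_cast h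

lemma toReal_Fstar : Q.Fstar.toReal = Q.FR xs := by
  have h : Q.Fstar = Q.F xs := le_antisymm (iInf_le _ xs) (le_iInf hxs)
  rw [h, hQ.F_eq_coe hg (hxs.mem_dom hQ hg hx), EReal.toReal_coe]

lemma exists_isMultiplier : ∃ y, Q.IsMultiplier xs y := by
  have hφ : ConvexOn ℝ Q.dom fun x => Q.fR x + Q.h x :=
    hQ.convexOn_fR.add (hQ.h_convex.subset (Set.subset_univ _) hQ.convexOn_fR.1)
  obtain ⟨y, hy⟩ := exists_multiplier Q.K hφ (hQ.convexOn_gR hg) (hQ.continuous_gR hg)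
    (hxs.mem_dom hQ hg hx) fun x hx => hxs.FR_le hQ hg hx
  refine ⟨y, fun x hx r => ?_⟩
  have h := hy x hx (r - Q.K x)
  rw [add_sub_cancel, ← neg_sub, inner_neg_right] at h
  rw [FR]
  linarith

end IsPrimalSolution

section

variable (hQ : Q.Assumptions μ L) {Mg : ℝ} (hg : IsLipschitzFun Mg Q.g) {xs x : BlockSpace p}
  {y : BlockSpace d}
include hQ hg

lemma IsMultiplier.G_le (hy : Q.IsMultiplier xs y) (hx : x ∈ Q.dom) :
    Q.G y ≤ ((-Q.FR xs : ℝ) : EReal) := by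
  have conj_le {x : BlockSpace p} (hx : x ∈ Q.dom) :
      conjugate (fun y => (Q.gR y : EReal)) y
        ≤ ((Q.fR x + Q.h x + inner ℝ y (Q.K x) - Q.FR xs : ℝ) : EReal) :=
    conjugate_le_coe_iff.2 fun r => by
      have := hy x hx r
      rw [inner_sub_right] at this
      linarith
  rw [G, hQ.g_eq hg]
  lift conjugate (fun y => (Q.gR y : EReal)) y to ℝ using
    ⟨((conj_le hx).trans_lt (EReal.coe_lt_top _)).ne, conjugate_ne_bot _ _⟩ with b
  have hphi : conjugate Q.phi (-(ContinuousLinearMap.adjoint Q.K y))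
      ≤ ((-Q.FR xs - b : ℝ) : EReal) := by
    refine iSup_le fun x => ?_
    by_cases hx : x ∈ Q.dom
    · have := EReal.coe_le_coe_iff.1 (conj_le hx)
      rw [phi, hQ.f_eq_coe hx, ← EReal.coe_add, ← EReal.coe_sub, inner_neg_left,
        ContinuousLinearMap.adjoint_inner_left, EReal.coe_le_coe_iff]
      linarith
    · rw [phi, hQ.f_eq_top hx, EReal.top_add_coe, EReal.sub_top]
      exact bot_le
  calc _ ≤ ((-Q.FR xs - b : ℝ) : EReal) + (b : EReal) := add_le_add_left hphi _
    _ = _ := by rw [← EReal.coe_add, sub_add_cancel]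

lemma isMultiplier_of_G_le (hy : Q.G y ≤ ((-Q.FR xs : ℝ) : EReal)) : Q.IsMultiplier xs y := by
  intro x hx r
  have hphi := le_iSup (fun x => ((inner ℝ (-(ContinuousLinearMap.adjoint Q.K y)) x : ℝ) : EReal)
    - Q.phi x) x
  simp only [phi, hQ.f_eq_coe hx, ← EReal.coe_add, ← EReal.coe_sub] at hphi
  rw [G, hQ.g_eq hg] at hy
  have h := (add_le_add hphi (coe_le_conjugate Q.gR y r)).trans hy
  rw [← EReal.coe_add, EReal.coe_le_coe_iff, inner_neg_left,
    ContinuousLinearMap.adjoint_inner_left] at h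
  rw [inner_sub_right]
  linarith

lemma IsDualSolution.isMultiplier (hy : Q.IsDualSolution y) (hxs : Q.IsPrimalSolution xs)
    (hx : x ∈ Q.dom) : Q.IsMultiplier xs y := by
  obtain ⟨y', hy'⟩ := hxs.exists_isMultiplier hQ hg hx
  exact isMultiplier_of_G_le hQ hg ((hy y').trans (hy'.G_le hQ hg hx))

end

end Problem


/-! ### One iteration -/

section

variable {H : Type*} [NormedAddCommGroup H] [InnerProductSpace ℝ H]

lemma multiplier_update_le {ρ : ℝ} (hρ : 0 < ρ) (yh ys v e u : H) :
    inner ℝ ys (v + e) + ρ / 2 * ‖v + e‖ ^ 2 + 1 / ρ * ‖yh + (ρ / 2) • (v + e - u) - ys‖ ^ 2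
      ≤ 1 / ρ * ‖yh - ys‖ ^ 2 + ρ / 2 * ‖u‖ ^ 2 + inner ℝ ys u
        + inner ℝ (yh + ρ • v) (v - u) + inner ℝ (yh + ρ • v) e + ρ * ‖e‖ ^ 2 := by
  have gap_eq : 1 / ρ * ‖yh - ys‖ ^ 2 + ρ / 2 * ‖u‖ ^ 2 + inner ℝ ys u
        + inner ℝ (yh + ρ • v) (v - u) + inner ℝ (yh + ρ • v) e + ρ * ‖e‖ ^ 2
      - (inner ℝ ys (v + e) + ρ / 2 * ‖v + e‖ ^ 2
        + 1 / ρ * ‖yh + (ρ / 2) • (v + e - u) - ys‖ ^ 2) = ρ / 4 * ‖v - u - e‖ ^ 2 := by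
    rw [add_sub_right_comm yh, norm_add_sq_real (yh - ys), norm_smul,
      Real.norm_of_nonneg (by positivity : 0 ≤ ρ / 2), inner_smul_right]
    simp only [mul_pow, ← real_inner_self_eq_norm_sq, inner_add_left, inner_add_right,
      inner_sub_left, inner_sub_right, inner_smul_left, conj_trivial]
    rw [real_inner_comm yh ys, real_inner_comm v u, real_inner_comm v e, real_inner_comm u e]
    field_simp
    ring
  have : 0 ≤ ρ / 4 * ‖v - u - e‖ ^ 2 := by positivity
  linarith

section

variable {γ μ : ℝ} {f : H → EReal} {G xt u : H} (h : IsProx γ f (xt - γ • G) u) (hγ : 0 < γ)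
  (hbot : ∀ x, f x ≠ ⊥) (hf : StrongConvexOn (effDom f) μ fun x => (f x).toReal)
include h hγ hbot hf

lemma IsProx.gradient_step {v : H} (hv : v ∈ effDom f) :
    (f u).toReal + inner ℝ G (u - xt) + γ⁻¹ / 2 * ‖u - xt‖ ^ 2
        + (γ⁻¹ + μ) / 2 * ‖u - v‖ ^ 2
      ≤ (f v).toReal + inner ℝ G (v - xt) + γ⁻¹ / 2 * ‖v - xt‖ ^ 2 := by
  have norm_sub_sq (w : H) : ‖w - (xt - γ • G)‖ ^ 2
      = ‖w - xt‖ ^ 2 + 2 * γ * inner ℝ G (w - xt) + γ ^ 2 * ‖G‖ ^ 2 := by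
    rw [← sub_add, norm_add_sq_real, norm_smul, inner_smul_right, Real.norm_of_nonneg hγ.le,
      real_inner_comm]
    ring
  have three_point := h.three_point hγ hbot hf hv
  rw [norm_sub_sq, norm_sub_sq] at three_point
  refine le_of_mul_le_mul_left ?_ hγ
  field_simp
  linarith

/-- The prox-gradient step is compared with the convex combination `(1 - a) x̃ + a x*`. -/
lemma IsProx.block_step {a : ℝ} (hμ : 0 ≤ μ) (ha : 0 ≤ a) (ha1 : a ≤ 1) {xs : H}
    (hxt : xt ∈ effDom f) (hxs : xs ∈ effDom f) :
    (f u).toReal - (f xt).toReal + inner ℝ G (u - xt) + γ⁻¹ / 2 * ‖u - xt‖ ^ 2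
      ≤ a * ((f xs).toReal - (f xt).toReal + inner ℝ G (xs - xt)
        + γ⁻¹ / 2 * (‖xt - xs‖ ^ 2 - ‖u - xs‖ ^ 2) - μ / 2 * ‖u - xs‖ ^ 2) := by
  have hb : 0 ≤ 1 - a := sub_nonneg.2 ha1
  set v := (1 - a) • xt + a • xs with hv
  have step := h.gradient_step hγ hbot hf (hf.1 hxt hxs hb ha (sub_add_cancel 1 a))
  have strong_convexity := hf.2 hxt hxs hb ha (sub_add_cancel 1 a)
  have norm_sub_v : ‖u - v‖ ^ 2
      = (1 - a) * ‖u - xt‖ ^ 2 + a * ‖u - xs‖ ^ 2 - (1 - a) * a * ‖xt - xs‖ ^ 2 := by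
    rw [show u - v = (1 - a) • (u - xt) + a • (u - xs) by rw [hv]; module,
      norm_combo_sq _ _ (sub_add_cancel 1 a), sub_sub_sub_cancel_left, norm_sub_rev xs]
  have hvx : v - xt = a • (xs - xt) := by rw [hv]; module
  rw [← hv, norm_sub_v, hvx, norm_smul, inner_smul_right, mul_pow, Real.norm_eq_abs, sq_abs,
    norm_sub_rev xs] at step
  simp only [← hv, smul_eq_mul] at strong_convexity
  have : 0 ≤ (γ⁻¹ + μ) / 2 * ((1 - a) * ‖u - xt‖ ^ 2) := by positivity
  linarith

end

end

section

variable {n m : ℕ} {p : Fin n → ℕ} {d : Fin m → ℕ} {x y : BlockSpace p} {i : Fin n}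

lemma sum_blocks_eq_add (h : ∀ l, l ≠ i → x l = y l)
    (φ : ∀ j, EuclideanSpace ℝ (Fin (p j)) → ℝ) :
    ∑ j, φ j (x j) = ∑ j, φ j (y j) + (φ i (x i) - φ i (y i)) := by
  have : ∑ j, (φ j (x j) - φ j (y j)) = φ i (x i) - φ i (y i) :=
    Finset.sum_eq_single i (fun l _ hl => by rw [h l hl, sub_self]) (by simp)
  rw [Finset.sum_sub_distrib] at this
  linarith

lemma wnormSq_sub_eq_add (h : ∀ l, l ≠ i → x l = y l) (w : Fin n → ℝ) (z : BlockSpace p) :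
    wnormSq w (x - z) = wnormSq w (y - z) + w i * (‖x i - z i‖ ^ 2 - ‖y i - z i‖ ^ 2) := by
  rw [mul_sub]
  exact sum_blocks_eq_add h fun j t => w j * ‖t - z j‖ ^ 2

lemma Problem.fR_eq_add (Q : Problem n m p d) (h : ∀ l, l ≠ i → x l = y l) :
    Q.fR x = Q.fR y + ((Q.fj i (x i)).toReal - (Q.fj i (y i)).toReal) :=
  sum_blocks_eq_add h fun j t => (Q.fj j t).toReal

variable {μ L σ : Fin n → ℝ}

lemma wnormSq_nonneg {w : Fin n → ℝ} (hw : ∀ j, 0 ≤ w j) (x : BlockSpace p) :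
    0 ≤ wnormSq w x :=
  Finset.sum_nonneg fun j _ => mul_nonneg (hw j) (sq_nonneg _)

lemma le_Lh_mul (hσ : ∀ j, 0 < σ j) (i : Fin n) : L i ≤ Lh L σ * σ i := by
  rw [← div_le_iff₀ (hσ i)]
  exact le_ciSup (f := fun j => L j / σ j) (Set.finite_range _).bddAbove i

lemma muF_mul_le (hσ : ∀ j, 0 < σ j) (i : Fin n) : muF μ σ * σ i ≤ μ i := by
  rw [← le_div_iff₀ (hσ i)]
  exact ciInf_le (f := fun j => μ j / σ j) (Set.finite_range _).bddBelow i

lemma muF_nonneg (hσ : ∀ j, 0 < σ j) (hμ : ∀ j, 0 < μ j) : 0 ≤ muF μ σ :=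
  Real.iInf_nonneg fun j => (div_pos (hμ j) (hσ j)).le

lemma Lh_nonneg (hσ : ∀ j, 0 < σ j) (hL : ∀ j, 0 ≤ L j) : 0 ≤ Lh L σ :=
  Real.iSup_nonneg fun j => div_nonneg (hL j) (hσ j).le

end

namespace Problem

variable {n m : ℕ} {p : Fin n → ℕ} {d : Fin m → ℕ}

/-- The Lagrangian `h(x) + g(r) + ⟪y, K x - r⟫` of the constraint `K x = r`, with the separable
term `f(x)` left out. -/
def lagrangian (Q : Problem n m p d) (y : BlockSpace d) (x : BlockSpace p) (r : BlockSpace d) : ℝ :=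
  Q.h x + Q.gR r + inner ℝ y (Q.K x - r)

/-- The Lagrangian gap with `f(x)` replaced by an upper bound `fb` for it. -/
def gap (Q : Problem n m p d) (xs : BlockSpace p) (ys : BlockSpace d) (fb : ℝ) (x : BlockSpace p)
    (r : BlockSpace d) : ℝ :=
  fb + Q.lagrangian ys x r - Q.FR xs

/-- The coefficient `2 L̄_σ ρ + L^h_σ` of the quadratic upper model of the augmented Lagrangian. -/
def curvature (Q : Problem n m p d) (L σ : Fin n → ℝ) (ρ : ℝ) : ℝ :=
  2 * Q.Lbar σ * ρ + Lh L σ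

variable {Q : Problem n m p d} {μ L σ q : Fin n → ℝ} (hQ : Q.Assumptions μ L)
include hQ

namespace Assumptions

lemma lagrangian_add_inner_le {xh : BlockSpace p} {y rp : BlockSpace d}
    (hsub : ∀ s, Q.gR rp + inner ℝ y (s - rp) ≤ Q.gR s) (x : BlockSpace p) (r : BlockSpace d) :
    Q.lagrangian y xh rp
        + inner ℝ (gradient Q.h xh + ContinuousLinearMap.adjoint Q.K y) (x - xh)
      ≤ Q.lagrangian y x r := by
  have h_le := add_inner_gradient_le hQ.h_convex hQ.h_diff xh x
  have g_le := hsub r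
  rw [inner_add_left, ContinuousLinearMap.adjoint_inner_left, map_sub]
  simp only [lagrangian, inner_sub_right] at *
  linarith

lemma lagrangian_combo_le {τ : ℝ} (hτ : 0 ≤ τ) (hτ1 : τ ≤ 1) {x xt xh : BlockSpace p}
    (hxh : xh = (1 - τ) • x + τ • xt) {y rp : BlockSpace d}
    (hsub : ∀ s, Q.gR rp + inner ℝ y (s - rp) ≤ Q.gR s) (r : BlockSpace d) (xs : BlockSpace p) :
    Q.lagrangian y xh rp
        + τ * inner ℝ (gradient Q.h xh + ContinuousLinearMap.adjoint Q.K y) (xs - xt)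
      ≤ (1 - τ) * Q.lagrangian y x r + τ * (Q.h xs + Q.gR (Q.K xs)) := by
  set G := gradient Q.h xh + ContinuousLinearMap.adjoint Q.K y
  have at_x := mul_le_mul_of_nonneg_left (hQ.lagrangian_add_inner_le (xh := xh) hsub x r)
    (sub_nonneg.2 hτ1)
  have at_xs := mul_le_mul_of_nonneg_left
    (hQ.lagrangian_add_inner_le (xh := xh) hsub xs (Q.K xs)) hτ
  have at_Kxs : Q.lagrangian y xs (Q.K xs) = Q.h xs + Q.gR (Q.K xs) := by
    rw [lagrangian, sub_self, inner_zero_right, add_zero]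
  have inner_combo : (1 - τ) * inner ℝ G (x - xh) + τ * inner ℝ G (xs - xh)
      = τ * inner ℝ G (xs - xt) := by
    simp only [← inner_smul_right (𝕜 := ℝ), ← inner_add_right]
    congr 1
    rw [hxh]
    module
  rw [at_Kxs] at at_xs
  linarith

lemma block_model_le (hσ : ∀ j, 0 < σ j) {ρ : ℝ} (hρ : 0 < ρ) {xh : BlockSpace p}
    {yh y rp : BlockSpace d} (hy : y = yh + ρ • (Q.K xh - rp)) (ys u : BlockSpace d) (i : Fin n)
    (t : EuclideanSpace ℝ (Fin (p i))) :
    Q.lagrangian ys (xh + blockEmbed i t) rp + ρ / 2 * ‖Q.K (xh + blockEmbed i t) - rp‖ ^ 2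
        + 1 / ρ * ‖yh + (ρ / 2) • (Q.K (xh + blockEmbed i t) - rp - u) - ys‖ ^ 2
      ≤ Q.lagrangian y xh rp + inner ℝ (ys - y) u + ρ / 2 * ‖u‖ ^ 2 + 1 / ρ * ‖yh - ys‖ ^ 2
        + inner ℝ ((gradient Q.h xh + ContinuousLinearMap.adjoint Q.K y) i) t
        + Q.curvature L σ ρ / 2 * (σ i * ‖t‖ ^ 2) := by
  have hKx : Q.K (xh + blockEmbed i t) - rp = (Q.K xh - rp) + Q.K (blockEmbed i t) := by
    rw [map_add]; abel
  have dual := multiplier_update_le hρ yh ys (Q.K xh - rp) (Q.K (blockEmbed i t)) u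
  have descent := block_descent hQ.h_diff (hQ.h_smooth i) xh t
  have quadratic_h := mul_le_mul_of_nonneg_right (le_Lh_mul (L := L) hσ i)
    (by positivity : 0 ≤ ‖t‖ ^ 2 / 2)
  have quadratic_K := mul_le_mul_of_nonneg_left (Q.norm_sq_K_blockEmbed_le hσ i t) hρ.le
  have hyt : inner ℝ y (Q.K (blockEmbed i t))
      = inner ℝ (ContinuousLinearMap.adjoint Q.K y i) t := by
    rw [← ContinuousLinearMap.adjoint_inner_left, inner_blockEmbed]
  rw [← hy, hyt, inner_sub_right y] at dual
  rw [PiLp.add_apply, inner_add_left, inner_sub_left, lagrangian, lagrangian, hKx, curvature]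
  linarith

lemma block_prox_le (hσ : ∀ j, 0 < σ j) {τ t0 κ : ℝ} (hτ : 0 < τ) (ht0 : 0 < t0) (hκ : 0 < κ)
    {i : Fin n} (hqi : t0 ≤ q i) {z xt xs G : EuclideanSpace ℝ (Fin (p i))}
    (hxt : xt ∈ effDom (Q.fj i)) (hxs : xs ∈ effDom (Q.fj i))
    (hprox : IsProx (t0 * (1 / κ) / (σ i * τ)) (Q.fj i)
      (xt - (t0 * (1 / κ) / (σ i * τ)) • G) z) :
    τ / t0 * ((Q.fj i z).toReal - (Q.fj i xt).toReal) + inner ℝ G ((τ / t0) • (z - xt))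
        + κ / 2 * (σ i * ‖(τ / t0) • (z - xt)‖ ^ 2)
        + τ * (τ / t0 * κ / 2 + muF μ σ / 2) * (σ i / q i * (‖z - xs‖ ^ 2 - ‖xt - xs‖ ^ 2))
      ≤ τ / q i * ((Q.fj i xs).toReal - (Q.fj i xt).toReal + inner ℝ G (xs - xt)
        - muF μ σ / 2 * (σ i * ‖xt - xs‖ ^ 2)) := by
  have hσi := hσ i
  have hq : 0 < q i := ht0.trans_le hqi
  have hγinv : (t0 * (1 / κ) / (σ i * τ))⁻¹ = σ i * (τ / t0 * κ) := by field_simp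
  have step := hprox.block_step (by positivity) (hQ.fj_proper i).1 (hQ.strongConvexOn_fj i)
    (a := t0 / q i) (hQ.μ_pos i).le (by positivity) (div_le_one_of_le₀ hqi hq.le) hxt hxs
  rw [hγinv] at step
  have scaled_step := mul_le_mul_of_nonneg_left step (by positivity : 0 ≤ τ / t0)
  have strong := mul_le_mul_of_nonneg_right (muF_mul_le (μ := μ) hσ i)
    (by positivity : 0 ≤ τ / q i / 2 * ‖z - xs‖ ^ 2)
  rw [← mul_assoc (τ / t0) (t0 / q i), div_mul_div_cancel₀ ht0.ne'] at scaled_step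
  rw [inner_smul_right, norm_smul, mul_pow, Real.norm_eq_abs, sq_abs]
  rw [← sub_nonneg] at scaled_step strong ⊢
  refine (add_nonneg scaled_step strong).trans_eq ?_
  ring

lemma block_iteration_le (hσ : ∀ j, 0 < σ j) {τ t0 ρ : ℝ} (hτ : 0 < τ) (ht0 : 0 < t0)
    (hρ : 0 < ρ) (hκ : 0 < Q.curvature L σ ρ) {xt xh xs : BlockSpace p}
    {yh y rp : BlockSpace d} (hxt : xt ∈ Q.dom) (hxs : xs ∈ Q.dom)
    (hy : y = yh + ρ • (Q.K xh - rp)) (ys u : BlockSpace d) (fb : ℝ) {i : Fin n}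
    (hqi : t0 ≤ q i) {X : BlockSpace p} (hkeep : ∀ l, l ≠ i → X l = xt l)
    (hprox : IsProx (t0 * (1 / Q.curvature L σ ρ) / (σ i * τ)) (Q.fj i)
      (xt i - (t0 * (1 / Q.curvature L σ ρ) / (σ i * τ)) •
        (gradient Q.h xh i + ContinuousLinearMap.adjoint Q.K y i)) (X i)) :
    Q.gap xs ys (fb + τ / t0 * (Q.fR X - Q.fR xt)) (xh + (τ / t0) • (X - xt)) rp
        + ρ / 2 * ‖Q.K (xh + (τ / t0) • (X - xt)) - rp‖ ^ 2
        + 1 / ρ * ‖yh + (ρ / 2) • (Q.K (xh + (τ / t0) • (X - xt)) - rp - u) - ys‖ ^ 2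
        + τ * (τ / t0 * Q.curvature L σ ρ / 2 + muF μ σ / 2)
          * wnormSq (fun j => σ j / q j) (X - xs)
      ≤ Q.gap xs y fb xh rp + inner ℝ (ys - y) u + ρ / 2 * ‖u‖ ^ 2 + 1 / ρ * ‖yh - ys‖ ^ 2
        + τ * (τ / t0 * Q.curvature L σ ρ / 2 + muF μ σ / 2)
          * wnormSq (fun j => σ j / q j) (xt - xs)
        + τ / q i * ((Q.fj i (xs i)).toReal - (Q.fj i (xt i)).toReal
          + inner ℝ ((gradient Q.h xh + ContinuousLinearMap.adjoint Q.K y) i) (xs i - xt i)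
          - muF μ σ / 2 * (σ i * ‖xt i - xs i‖ ^ 2)) := by
  have hinc : (τ / t0) • (X - xt) = blockEmbed i ((τ / t0) • (X i - xt i)) := by
    rw [blockEmbed_smul, ← sub_eq_blockEmbed hkeep]
  have model := hQ.block_model_le hσ hρ hy ys u i ((τ / t0) • (X i - xt i))
  have prox := hQ.block_prox_le hσ hτ ht0 hκ hqi (hxt i) (hxs i)
    (G := (gradient Q.h xh + ContinuousLinearMap.adjoint Q.K y) i) hprox
  rw [wnormSq_sub_eq_add hkeep, Q.fR_eq_add hkeep, hinc, gap, gap]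
  linarith

lemma sum_block_linearization_le (hσ : ∀ j, 0 < σ j) {t0 : ℝ} (ht0 : 0 < t0)
    (hq : ∀ j, t0 ≤ q j) (G xt xs : BlockSpace p) :
    ∑ i, ((Q.fj i (xs i)).toReal - (Q.fj i (xt i)).toReal + inner ℝ (G i) (xs i - xt i)
        - muF μ σ / 2 * (σ i * ‖xt i - xs i‖ ^ 2))
      ≤ Q.fR xs - Q.fR xt + inner ℝ G (xs - xt)
        - muF μ σ / 2 * (t0 * wnormSq (fun j => σ j / q j) (xt - xs)) := by
  have weight_le : t0 * wnormSq (fun j => σ j / q j) (xt - xs) ≤ ∑ i, σ i * ‖xt i - xs i‖ ^ 2 := by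
    rw [wnormSq, Finset.mul_sum]
    refine Finset.sum_le_sum fun i _ => ?_
    rw [← mul_assoc, mul_div_assoc', PiLp.sub_apply]
    gcongr
    rw [div_le_iff₀ (ht0.trans_le (hq i)), mul_comm]
    exact mul_le_mul_of_nonneg_left (hq i) (hσ i).le
  have := mul_le_mul_of_nonneg_left weight_le
    (div_nonneg (muF_nonneg hσ hQ.μ_pos) zero_le_two)
  rw [Finset.sum_sub_distrib, Finset.sum_add_distrib, Finset.sum_sub_distrib, ← Finset.mul_sum,
    PiLp.inner_apply]
  simp only [fR, PiLp.sub_apply]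
  linarith

lemma average_iteration_le (hσ : ∀ j, 0 < σ j) (hq1 : ∑ j, q j = 1) {τ t0 ρ : ℝ} (hτ : 0 < τ)
    (hτ1 : τ ≤ 1) (ht0 : 0 < t0) (hq : ∀ j, t0 ≤ q j) (hρ : 0 < ρ)
    (hκ : 0 < Q.curvature L σ ρ) {x xt xh xs : BlockSpace p} {yh y rp : BlockSpace d}
    (hxt : xt ∈ Q.dom) (hxs : xs ∈ Q.dom) (hxh : xh = (1 - τ) • x + τ • xt)
    (hy : y = yh + ρ • (Q.K xh - rp)) (hsub : ∀ s, Q.gR rp + inner ℝ y (s - rp) ≤ Q.gR s)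
    (ys r : BlockSpace d) (fb : ℝ) {X : Fin n → BlockSpace p}
    (hkeep : ∀ i l, l ≠ i → X i l = xt l)
    (hprox : ∀ i, IsProx (t0 * (1 / Q.curvature L σ ρ) / (σ i * τ)) (Q.fj i)
      (xt i - (t0 * (1 / Q.curvature L σ ρ) / (σ i * τ)) •
        (gradient Q.h xh i + ContinuousLinearMap.adjoint Q.K y i)) (X i i)) :
    ∑ i, q i * (Q.gap xs ys ((1 - τ) * fb + τ * Q.fR xt + τ / t0 * (Q.fR (X i) - Q.fR xt))
          (xh + (τ / t0) • (X i - xt)) rp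
        + ρ / 2 * ‖Q.K (xh + (τ / t0) • (X i - xt)) - rp‖ ^ 2
        + 1 / ρ * ‖yh + (ρ / 2) • (Q.K (xh + (τ / t0) • (X i - xt)) - rp
          - (1 - τ) • (Q.K x - r)) - ys‖ ^ 2
        + τ * (τ / t0 * Q.curvature L σ ρ / 2 + muF μ σ / 2)
          * wnormSq (fun j => σ j / q j) (X i - xs))
      ≤ (1 - τ) * Q.gap xs ys fb x r + ρ / 2 * ((1 - τ) ^ 2 * ‖Q.K x - r‖ ^ 2)
        + 1 / ρ * ‖yh - ys‖ ^ 2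
        + τ * (τ / t0 * Q.curvature L σ ρ / 2 + muF μ σ / 2 * (1 - t0))
          * wnormSq (fun j => σ j / q j) (xt - xs) := by
  set G := gradient Q.h xh + ContinuousLinearMap.adjoint Q.K y
  set u := (1 - τ) • (Q.K x - r) with hu
  set N := wnormSq (fun j => σ j / q j) (xt - xs)
  set C := Q.gap xs y ((1 - τ) * fb + τ * Q.fR xt) xh rp + inner ℝ (ys - y) u
    + ρ / 2 * ‖u‖ ^ 2 + 1 / ρ * ‖yh - ys‖ ^ 2
    + τ * (τ / t0 * Q.curvature L σ ρ / 2 + muF μ σ / 2) * N with hC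
  have q_pos (i : Fin n) : 0 < q i := ht0.trans_le (hq i)
  have linearization := mul_le_mul_of_nonneg_left
    (hQ.sum_block_linearization_le hσ ht0 hq G xt xs) hτ.le
  have combo := hQ.lagrangian_combo_le hτ.le hτ1 hxh hsub r xs
  refine (Finset.sum_le_sum fun i _ => mul_le_mul_of_nonneg_left (hQ.block_iteration_le hσ hτ ht0
    hρ hκ hxt hxs hy ys u _ (hq i) (hkeep i) (hprox i)) (q_pos i).le).trans ?_
  calc ∑ i, q i * (C + τ / q i * ((Q.fj i (xs i)).toReal - (Q.fj i (xt i)).toReal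
        + inner ℝ (G i) (xs i - xt i) - muF μ σ / 2 * (σ i * ‖xt i - xs i‖ ^ 2)))
      = C + τ * ∑ i, ((Q.fj i (xs i)).toReal - (Q.fj i (xt i)).toReal
        + inner ℝ (G i) (xs i - xt i) - muF μ σ / 2 * (σ i * ‖xt i - xs i‖ ^ 2)) := by
        simp only [mul_add (q _), Finset.sum_add_distrib, ← Finset.sum_mul, hq1, one_mul,
          ← mul_assoc, mul_div_cancel₀ _ (q_pos _).ne', Finset.mul_sum]
    _ ≤ _ := by
        have multiplier_shift : inner ℝ (ys - y) u
            = (1 - τ) * (Q.lagrangian ys x r - Q.lagrangian y x r) := by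
          rw [hu, inner_smul_right, inner_sub_left, lagrangian, lagrangian]
          ring
        rw [hC, multiplier_shift, hu, norm_smul, mul_pow, Real.norm_eq_abs, sq_abs]
        simp only [gap, FR]
        linarith

end Assumptions

end Problem

/-! ### The iterates along a run -/

lemma averaging_mem {V : Type*} [AddCommGroup V] [Module ℝ V] {C : Set V} (hC : Convex ℝ C)
    {τ θ : ℕ → ℝ} {u w : ℕ → V} (hτ : ∀ k, 0 ≤ τ k) (hτ1 : ∀ k, τ k ≤ 1) (hθ : ∀ k, 0 < θ k)
    (hθ1 : θ 0 ≤ 1) (hanti : Antitone θ) (hw : ∀ k, w k ∈ C) (h0 : u 0 = w 0)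
    (hu : ∀ k, u (k + 1) = (1 - τ k) • u k + τ k • w k + θ k • (w (k + 1) - w k)) (k : ℕ) :
    u k ∈ C := by
  -- Membership is not inductive; that `u k` keeps its weight `θ k` on `w k` movable in `C` is.
  suffices movable : ∀ k, ∀ v ∈ C, u k + θ k • (v - w k) ∈ C by
    simpa using movable k (w k) (hw k)
  have combo {a : ℝ} {x y : V} (ha : 0 ≤ a) (ha1 : a ≤ 1) (hx : x ∈ C) (hy : y ∈ C) :
      x + a • (y - x) ∈ C := hC.add_smul_sub_mem hx hy ⟨ha, ha1⟩
  have θ_le_one (k : ℕ) : θ k ≤ 1 := (hanti k.zero_le).trans hθ1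
  intro k
  induction k with
  | zero => intro v hv; rw [h0]; exact combo (hθ 0).le hθ1 (hw 0) hv
  | succ k ih =>
    intro v hv
    set z := w (k + 1) + (θ (k + 1) / θ k) • (v - w (k + 1)) with hz
    have hzC : z ∈ C := combo (div_pos (hθ _) (hθ _)).le
      ((div_le_one (hθ k)).2 (hanti k.le_succ)) (hw _) hv
    have θ_smul : θ k • (z - w (k + 1)) = θ (k + 1) • (v - w (k + 1)) := by
      rw [hz, add_sub_cancel_left, smul_smul, mul_div_cancel₀ _ (hθ k).ne']
    convert hC (ih z hzC) (combo (hθ k).le (θ_le_one k) (hw k) hzC) (sub_nonneg.2 (hτ1 k)) (hτ k)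
      (by ring) using 1
    rw [← θ_smul, hu]
    module

/-- The growth factor `(k + c - 1) / c` of the parameters: `τ_k = τ₀ / scale c (k + 1)` and
`ρ_k = ρ₀ (scale c (k + 1))²`. -/
def scale (c : ℝ) (k : ℕ) : ℝ := (k + c - 1) / c

lemma scale_succ (c : ℝ) (k : ℕ) : scale c (k + 1) = scale c k + 1 / c := by
  rw [scale, scale]
  push_cast
  ring

lemma scale_pos {c : ℝ} (hc : 2 < c) (k : ℕ) : 0 < scale c k := by
  have : (0 : ℝ) ≤ k := k.cast_nonneg
  exact div_pos (by linarith) (by linarith)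

lemma one_le_scale_succ {c : ℝ} (hc : 2 < c) (k : ℕ) : 1 ≤ scale c (k + 1) := by
  rw [scale, one_le_div (by linarith)]
  push_cast
  linarith [k.cast_nonneg (α := ℝ)]

lemma scale_zero_le {c : ℝ} (hc : 2 < c) : scale c 0 ≤ 1 := by
  rw [scale, div_le_one (by linarith)]
  push_cast
  linarith

lemma scale_mono {c : ℝ} (hc : 2 < c) : Monotone (scale c) := by
  intro k l hkl
  rw [scale, scale]
  gcongr

lemma le_mul_scale {c : ℝ} (hc : 2 < c) (k : ℕ) : k ≤ c * scale c k := by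
  rw [scale, mul_div_cancel₀ _ (by linarith)]
  linarith

section Iterates

variable {n m : ℕ} {p : Fin n → ℕ} {d : Fin m → ℕ}

namespace Iterates

variable (S : Iterates p d) (Q : Problem n m p d) (A : Params) (t0 : ℝ)

/-- The point `r^k` at which `y^k` is a subgradient of `g` when `k ≥ 1`.  As in `IsRun`, the index
`k - 1` is truncated at `0`, and in a run this gives `r^0 = K x^0`. -/
def dualPoint (k : ℕ) : BlockSpace d :=
  Q.K (S.xh (k - 1)) + (A.ρ (k - 1))⁻¹ • (S.yh (k - 1) - S.y k)

/-- The residual `K x^k - r^k`. -/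
def residual (k : ℕ) : BlockSpace d := Q.K (S.x k) - S.dualPoint Q A k

/-- The average of the values `f(x̃^l)`, `l ≤ k`, with the weights by which `x^k` averages the
points `x̃^l`.  It bounds `f(x^k)` from above and, unlike `f(x^k)`, is affine in `f(x̃^{k+1})`. -/
def averagedF : ℕ → ℝ
  | 0 => Q.fR (S.x 0)
  | k + 1 => (1 - A.τ k) * averagedF k + A.τ k * Q.fR (S.xt k)
      + A.τ k / t0 * (Q.fR (S.xt (k + 1)) - Q.fR (S.xt k))

/-- The Lagrangian gap of the iterates at time `k`. -/
def gap (xs : BlockSpace p) (ys : BlockSpace d) (k : ℕ) : ℝ :=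
  Q.gap xs ys (S.averagedF Q A t0 k) (S.x k) (S.dualPoint Q A k)

/-- Two sequences of iterates agree up to time `k`.  Since `y^{k+1}` is computed before the `k`-th
draw, the multipliers are required to agree one step further. -/
structure AgreeUpTo (S S' : Iterates p d) (k : ℕ) : Prop where
  x : ∀ i ≤ k, S.x i = S'.x i
  xt : ∀ i ≤ k, S.xt i = S'.xt i
  xh : ∀ i ≤ k, S.xh i = S'.xh i
  yh : ∀ i ≤ k, S.yh i = S'.yh i
  y : ∀ i ≤ k + 1, S.y i = S'.y i

namespace AgreeUpTo

variable {S Q A t0} {S' : Iterates p d} {k : ℕ} (h : AgreeUpTo S S' k)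
include h

lemma dualPoint_eq {i : ℕ} (hi : i ≤ k + 1) : S.dualPoint Q A i = S'.dualPoint Q A i := by
  have hi' : i - 1 ≤ k := Nat.sub_le_of_le_add hi
  rw [dualPoint, dualPoint, h.xh _ hi', h.yh _ hi', h.y i hi]

lemma residual_eq : S.residual Q A k = S'.residual Q A k := by
  rw [residual, residual, h.x k le_rfl, h.dualPoint_eq k.le_succ]

lemma averagedF_eq : S.averagedF Q A t0 k = S'.averagedF Q A t0 k := by
  suffices ∀ i ≤ k, S.averagedF Q A t0 i = S'.averagedF Q A t0 i from this k le_rfl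
  intro i hi
  induction i with
  | zero => rw [averagedF, averagedF, h.x 0 hi]
  | succ i ih =>
    rw [averagedF, averagedF, ih (i.le_succ.trans hi), h.xt i (i.le_succ.trans hi), h.xt _ hi]

lemma gap_eq (xs : BlockSpace p) (ys : BlockSpace d) :
    S.gap Q A t0 xs ys k = S'.gap Q A t0 xs ys k := by
  rw [gap, gap, h.averagedF_eq, h.x k le_rfl, h.dualPoint_eq k.le_succ]

end AgreeUpTo

end Iterates

end Iterates

/-- The assumptions of the convergence analysis on the problem `Q` and on the parameters, for an
arbitrary sampling distribution `q` on the blocks whose entries are at least `t0 = τ₀`. -/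
structure Setting {n m : ℕ} {p : Fin n → ℕ} {d : Fin m → ℕ} (Q : Problem n m p d)
    (μ L σ q : Fin n → ℝ) (Mg t0 c ρ0 : ℝ) (A : Params) : Prop where
  assumptions : Q.Assumptions μ L
  lipschitz : IsLipschitzFun Mg Q.g
  σ_pos : ∀ j, 0 < σ j
  q_sum : ∑ j, q j = 1
  t0_le_q : ∀ j, t0 ≤ q j
  two_lt_c : 2 < c
  two_lt_mul : 2 < c * t0
  ρ0_pos : 0 < ρ0
  ρ0_le : 8 * Q.Lbar σ * ρ0 ≤ muF μ σ
  L_pos : 0 < Q.Lbar σ + Lh L σ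
  rule : A = paramRule c t0 ρ0 (Q.Lbar σ) (Lh L σ)

namespace Setting

variable {n m : ℕ} {p : Fin n → ℕ} {d : Fin m → ℕ} {Q : Problem n m p d} {μ L σ q : Fin n → ℝ}
  {Mg t0 c ρ0 : ℝ} {A : Params} (hs : Setting Q μ L σ q Mg t0 c ρ0 A)
include hs

lemma t0_pos : 0 < t0 :=
  pos_of_mul_pos_right (zero_lt_two.trans hs.two_lt_mul) (zero_lt_two.trans hs.two_lt_c).le

lemma q_pos (j : Fin n) : 0 < q j := hs.t0_pos.trans_le (hs.t0_le_q j)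

lemma t0_le_one : t0 ≤ 1 := by
  obtain ⟨j, -, -⟩ := Finset.exists_ne_zero_of_sum_ne_zero (hs.q_sum.trans_ne one_ne_zero)
  exact (hs.t0_le_q j).trans (hs.q_sum ▸
    Finset.single_le_sum (fun i _ => (hs.q_pos i).le) (Finset.mem_univ j))

lemma two_div_lt : 2 / c < t0 := by
  rw [div_lt_iff₀' (zero_lt_two.trans hs.two_lt_c)]
  exact hs.two_lt_mul

lemma weight_nonneg (j : Fin n) : 0 ≤ σ j / q j := (div_pos (hs.σ_pos j) (hs.q_pos j)).le

lemma curvature_pos {ρ : ℝ} (hρ : 0 < ρ) : 0 < Q.curvature L σ ρ := by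
  have hLh := Lh_nonneg hs.σ_pos hs.assumptions.L_nonneg
  have hLbar : 0 ≤ Q.Lbar σ := sq_nonneg _
  rcases hLbar.eq_or_lt with h | h
  · simpa [Problem.curvature, ← h] using hs.L_pos
  · exact add_pos_of_pos_of_nonneg (by positivity) hLh

lemma τ_eq (k : ℕ) : A.τ k = t0 / scale c (k + 1) := by
  rw [hs.rule, scale, paramRule]
  push_cast
  rw [show (k : ℝ) + 1 + c - 1 = k + c by ring, div_div_eq_mul_div, mul_comm c]

lemma ρ_eq (k : ℕ) : A.ρ k = ρ0 * scale c (k + 1) ^ 2 := by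
  have ρ_def : A.ρ k = ρ0 * t0 ^ 2 / A.τ k ^ 2 := by rw [hs.rule, paramRule]
  rw [ρ_def, hs.τ_eq, div_pow, mul_div_assoc, div_div_cancel₀ (pow_ne_zero 2 hs.t0_pos.ne')]

lemma β_eq (k : ℕ) : A.β k = 1 / Q.curvature L σ (A.ρ k) := by rw [hs.rule]; rfl

lemma η_eq (k : ℕ) : A.η k = A.ρ k / 2 := by rw [hs.rule]; rfl

lemma τ_pos (k : ℕ) : 0 < A.τ k := by
  rw [hs.τ_eq]
  exact div_pos hs.t0_pos (scale_pos hs.two_lt_c _)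

lemma τ_le_one (k : ℕ) : A.τ k ≤ 1 := by
  rw [hs.τ_eq, div_le_one (scale_pos hs.two_lt_c _)]
  exact hs.t0_le_one.trans (one_le_scale_succ hs.two_lt_c k)

lemma ρ_pos (k : ℕ) : 0 < A.ρ k := by
  rw [hs.ρ_eq]
  exact mul_pos hs.ρ0_pos (pow_pos (scale_pos hs.two_lt_c _) 2)

lemma step_pos (k : ℕ) (i : Fin n) : 0 < t0 * A.β k / (σ i * A.τ k) := by
  rw [hs.β_eq]
  have := hs.curvature_pos (hs.ρ_pos k)
  have := hs.τ_pos k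
  have := hs.σ_pos i
  have := hs.t0_pos
  positivity

section Run

variable {x0 : BlockSpace p} {yh0 : BlockSpace d} {jk : ℕ → Fin n} {S : Iterates p d}
  (hS : IsRun Q σ t0 A x0 yh0 jk S)
include hS

omit hs in
lemma dualPoint_zero : S.dualPoint Q A 0 = Q.K x0 := by
  have hxh : S.xh 0 = x0 := by
    rw [hS.xh_eq, hS.x_zero, hS.xt_zero]
    module
  rw [Iterates.dualPoint, hxh, hS.yh_zero, hS.y_zero, sub_self, smul_zero, add_zero]

omit hS in
lemma y_succ_eq (k : ℕ) :
    S.y (k + 1) = S.yh k + A.ρ k • (Q.K (S.xh k) - S.dualPoint Q A (k + 1)) := by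
  rw [Iterates.dualPoint, Nat.add_sub_cancel, sub_add_cancel_left, smul_neg,
    smul_inv_smul₀ (hs.ρ_pos k).ne']
  abel

lemma y_succ_subgradient (k : ℕ) (s : BlockSpace d) :
    Q.gR (S.dualPoint Q A (k + 1)) + inner ℝ (S.y (k + 1)) (s - S.dualPoint Q A (k + 1))
      ≤ Q.gR s := by
  have center : S.yh k + A.ρ k • Q.K (S.xh k)
      = S.y (k + 1) + A.ρ k • S.dualPoint Q A (k + 1) := by
    rw [hs.y_succ_eq]
    module
  have h := hS.y_succ k
  rw [hs.assumptions.g_eq hs.lipschitz, center] at h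
  exact h.subgradient_of_conjugate (hs.assumptions.convexOn_gR hs.lipschitz)
    (hs.assumptions.continuous_gR hs.lipschitz) (hs.ρ_pos k) s

lemma yh_succ_eq (k : ℕ) : S.yh (k + 1) = S.yh k + (A.ρ k / 2) •
    (S.residual Q A (k + 1) - (1 - A.τ k) • S.residual Q A k) := by
  have halve : A.ρ k / 2 / A.ρ k = 1 / 2 := by rw [div_right_comm, div_self (hs.ρ_pos k).ne']
  have cancel : A.ρ k / 2 * (A.ρ k)⁻¹ = 1 / 2 := by rw [← div_eq_mul_inv, halve]
  rw [hS.yh_succ, hs.η_eq, halve]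
  simp only [Iterates.residual, Iterates.dualPoint, Nat.add_sub_cancel, map_sub, map_smul]
  generalize Q.K (S.x (k + 1)) = u, Q.K (S.x k) = v, Q.K (S.xh k) = w, Q.K (S.xh (k - 1)) = w'
  have expand (a b : BlockSpace d) : (A.ρ k / 2) • (u - (w + (A.ρ k)⁻¹ • a) - b)
      = (A.ρ k / 2) • (u - w) - (1 / 2 : ℝ) • a - (A.ρ k / 2) • b := by
    rw [← cancel]
    module
  rw [expand]
  module

lemma y_succ_unique {jk' : ℕ → Fin n} {S' : Iterates p d} (hS' : IsRun Q σ t0 A x0 yh0 jk' S')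
    {k : ℕ} (hyh : S.yh k = S'.yh k) (hxh : S.xh k = S'.xh k) : S.y (k + 1) = S'.y (k + 1) := by
  have h := hS.y_succ k
  have h' := hS'.y_succ k
  rw [← hyh, ← hxh] at h'
  rw [hs.assumptions.g_eq hs.lipschitz] at h h'
  exact h.unique_of_conjugate (hs.assumptions.convexOn_gR hs.lipschitz)
    (hs.assumptions.continuous_gR hs.lipschitz) (hs.ρ_pos k) h'

variable (hx0 : x0 ∈ Q.dom)
include hx0

lemma xt_succ_unique {jk' : ℕ → Fin n} {S' : Iterates p d} (hS' : IsRun Q σ t0 A x0 yh0 jk' S')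
    {k : ℕ} (hjk : jk k = jk' k) (hxt : S.xt k = S'.xt k) (hxh : S.xh k = S'.xh k)
    (hy : S.y (k + 1) = S'.y (k + 1)) : S.xt (k + 1) = S'.xt (k + 1) := by
  ext b : 1
  by_cases hb : b = jk k
  · have h := hS.xt_draw k b hb
    have h' := hS'.xt_draw k b (hb.trans hjk)
    rw [← hxt, ← hxh, ← hy] at h'
    exact h.unique (hs.step_pos k b) (hs.assumptions.fj_proper b).1 ⟨x0 b, hx0 b⟩
      (hs.assumptions.μ_pos b).le (hs.assumptions.strongConvexOn_fj b) h'
  · rw [hS.xt_keep k b hb, hS'.xt_keep k b (hjk ▸ hb), hxt]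

lemma agreeUpTo_of_draws {jk' : ℕ → Fin n} {S' : Iterates p d}
    (hS' : IsRun Q σ t0 A x0 yh0 jk' S') {k : ℕ} (h : ∀ i < k, jk i = jk' i) :
    S.AgreeUpTo S' k := by
  have agree_xh {i : ℕ} (hx : S.x i = S'.x i) (hxt : S.xt i = S'.xt i) : S.xh i = S'.xh i := by
    rw [hS.xh_eq, hS'.xh_eq, hx, hxt]
  induction k with
  | zero =>
    have hx : S.x 0 = S'.x 0 := hS.x_zero.trans hS'.x_zero.symm
    have hxt : S.xt 0 = S'.xt 0 := hS.xt_zero.trans hS'.xt_zero.symm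
    have hyh : S.yh 0 = S'.yh 0 := hS.yh_zero.trans hS'.yh_zero.symm
    have hy : S.y 0 = S'.y 0 := hS.y_zero.trans hS'.y_zero.symm
    have hy1 := hs.y_succ_unique hS hS' hyh (agree_xh hx hxt)
    constructor <;> intro i hi <;> interval_cases i <;> first | assumption | exact agree_xh hx hxt
  | succ k ih =>
    have ih := ih fun i hi => h i (hi.trans k.lt_succ_self)
    have hxt := hs.xt_succ_unique hS hx0 hS' (h k k.lt_succ_self) (ih.xt k le_rfl)
      (ih.xh k le_rfl) (ih.y _ le_rfl)
    have hx : S.x (k + 1) = S'.x (k + 1) := by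
      rw [hS.x_succ, hS'.x_succ, ih.xh k le_rfl, hxt, ih.xt k le_rfl]
    have hyh : S.yh (k + 1) = S'.yh (k + 1) := by
      rw [hS.yh_succ, hS'.yh_succ, ih.yh _ (Nat.sub_le k 1), ih.yh k le_rfl, ih.y _ le_rfl, hx,
        ih.xh k le_rfl, ih.x k le_rfl, ih.xh _ (Nat.sub_le k 1), ih.y k k.le_succ]
    have extend {P : ℕ → Prop} {l : ℕ} (hl : ∀ i ≤ l, P i) (hl' : P (l + 1)) :
        ∀ i ≤ l + 1, P i := fun i hi => (Nat.le_succ_iff.1 hi).elim (hl i) (· ▸ hl')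
    exact ⟨extend ih.x hx, extend ih.xt hxt, extend ih.xh (agree_xh hx hxt), extend ih.yh hyh,
      extend ih.y (hs.y_succ_unique hS hS' hyh (agree_xh hx hxt))⟩

lemma xt_mem_dom (k : ℕ) : S.xt k ∈ Q.dom := by
  induction k with
  | zero => rw [hS.xt_zero]; exact hx0
  | succ k ih =>
    intro i
    by_cases hi : i = jk k
    · exact (hS.xt_draw k i hi).mem_effDom (hs.step_pos k i) (hs.assumptions.fj_proper i).1 (ih i)
    · rw [hS.xt_keep k i hi]
      exact ih i

lemma x_mem_dom_and_fR_le (k : ℕ) : S.x k ∈ Q.dom ∧ Q.fR (S.x k) ≤ S.averagedF Q A t0 k := by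
  have hc := hs.two_lt_c
  have τ_div_t0 (k : ℕ) : A.τ k / t0 = 1 / scale c (k + 1) := by
    rw [hs.τ_eq, div_div_cancel_left' hs.t0_pos.ne', one_div]
  have antitone_θ : Antitone fun k => A.τ k / t0 := fun k l hkl => by
    simp only [τ_div_t0]
    exact one_div_le_one_div_of_le (scale_pos hc _) (scale_mono hc (by gcongr))
  refine averaging_mem (C := {z : BlockSpace p × ℝ | z.1 ∈ Q.dom ∧ Q.fR z.1 ≤ z.2})
    (u := fun k => (S.x k, S.averagedF Q A t0 k)) (w := fun k => (S.xt k, Q.fR (S.xt k)))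
    hs.assumptions.convexOn_fR.convex_epigraph (fun k => (hs.τ_pos k).le) hs.τ_le_one
    (fun k => div_pos (hs.τ_pos k) hs.t0_pos) ?_ antitone_θ
    (fun k => ⟨hs.xt_mem_dom hS hx0 k, le_rfl⟩) ?_ (fun k => ?_) k
  · rw [τ_div_t0, div_le_one (scale_pos hc _)]
    exact one_le_scale_succ hc 0
  · simp only [Iterates.averagedF, hS.x_zero, hS.xt_zero]
  · simp [Iterates.averagedF, hS.x_succ, hS.xh_eq]

lemma gap_nonneg {xs : BlockSpace p} {ys : BlockSpace d} (hys : Q.IsMultiplier xs ys) (k : ℕ) :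
    0 ≤ S.gap Q A t0 xs ys k := by
  obtain ⟨hx, hf⟩ := hs.x_mem_dom_and_fR_le hS hx0 k
  have := hys _ hx (S.dualPoint Q A k)
  rw [Iterates.gap, Problem.gap, Problem.lagrangian]
  linarith

end Run

end Setting

namespace Iterates

variable {n m : ℕ} {p : Fin n → ℕ} {d : Fin m → ℕ} (S : Iterates p d) (Q : Problem n m p d)
  (A : Params)

/-- The Lagrangian gap at time `k` plus the weighted squared residual: the part of the Lyapunov
function that controls the objective. -/
def energy (t0 c ρ0 : ℝ) (xs : BlockSpace p) (ys : BlockSpace d) (k : ℕ) : ℝ :=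
  S.gap Q A t0 xs ys k + ρ0 / 2 * (scale c k ^ 2 * ‖S.residual Q A k‖ ^ 2)

/-- The Lyapunov function of the method. -/
def lyapunov (μ L σ q : Fin n → ℝ) (t0 c ρ0 : ℝ) (xs : BlockSpace p) (ys : BlockSpace d) (k : ℕ) :
    ℝ :=
  scale c k ^ 2 * S.energy Q A t0 c ρ0 xs ys k + 1 / ρ0 * ‖S.yh k - ys‖ ^ 2
    + t0 * (Q.curvature L σ (ρ0 * scale c k ^ 2) / 2 + muF μ σ / 2 * scale c k)
      * wnormSq (fun j => σ j / q j) (S.xt k - xs)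

variable {S Q A}

lemma AgreeUpTo.energy_eq {S' : Iterates p d} {k : ℕ} (h : S.AgreeUpTo S' k) (t0 c ρ0 : ℝ)
    (xs : BlockSpace p) (ys : BlockSpace d) :
    S.energy Q A t0 c ρ0 xs ys k = S'.energy Q A t0 c ρ0 xs ys k := by
  rw [energy, energy, h.gap_eq, h.residual_eq]

lemma AgreeUpTo.lyapunov_eq {S' : Iterates p d} {k : ℕ} (h : S.AgreeUpTo S' k)
    (μ L σ q : Fin n → ℝ) (t0 c ρ0 : ℝ) (xs : BlockSpace p) (ys : BlockSpace d) :
    S.lyapunov Q A μ L σ q t0 c ρ0 xs ys k = S'.lyapunov Q A μ L σ q t0 c ρ0 xs ys k := by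
  rw [lyapunov, lyapunov, h.energy_eq, h.yh k le_rfl, h.xt k le_rfl]

end Iterates

namespace Setting

variable {n m : ℕ} {p : Fin n → ℕ} {d : Fin m → ℕ} {Q : Problem n m p d} {μ L σ q : Fin n → ℝ}
  {Mg t0 c ρ0 : ℝ} {A : Params} (hs : Setting Q μ L σ q Mg t0 c ρ0 A)
include hs

lemma scale_sq_mul_one_sub_τ_le (k : ℕ) :
    scale c (k + 1) ^ 2 * (1 - A.τ k) + (t0 - 2 / c) * scale c (k + 1) ≤ scale c k ^ 2 := by
  have hS := (scale_pos hs.two_lt_c (k + 1)).ne'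
  calc scale c (k + 1) ^ 2 * (1 - A.τ k) + (t0 - 2 / c) * scale c (k + 1)
      = (scale c (k + 1) - 1 / c) ^ 2 - (1 / c) ^ 2 := by rw [hs.τ_eq]; field_simp; ring
    _ ≤ (scale c (k + 1) - 1 / c) ^ 2 := sub_le_self _ (sq_nonneg _)
    _ = scale c k ^ 2 := by rw [scale_succ, add_sub_cancel_right]

lemma scale_pow_four_mul_one_sub_τ_sq_le (k : ℕ) :
    scale c (k + 1) ^ 4 * (1 - A.τ k) ^ 2 + (t0 - 2 / c) * (scale c (k + 1) * scale c k ^ 2)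
      ≤ scale c k ^ 4 := by
  have hle := hs.scale_sq_mul_one_sub_τ_le k
  have hdecay : 0 ≤ (t0 - 2 / c) * scale c (k + 1) :=
    mul_nonneg (sub_nonneg.2 hs.two_div_lt.le) (scale_pos hs.two_lt_c _).le
  have hnonneg : 0 ≤ scale c (k + 1) ^ 2 * (1 - A.τ k) :=
    mul_nonneg (sq_nonneg _) (sub_nonneg.2 (hs.τ_le_one k))
  have := mul_le_mul_of_nonneg_left (le_of_add_le_of_nonneg_left hle hdecay) hnonneg
  have := mul_le_mul_of_nonneg_right hle (sq_nonneg (scale c k))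
  linarith

lemma curvature_succ_le (k : ℕ) :
    Q.curvature L σ (A.ρ k) / 2 + muF μ σ / 2 * (scale c (k + 1) * (1 - t0))
      ≤ Q.curvature L σ (ρ0 * scale c k ^ 2) / 2 + muF μ σ / 2 * scale c k := by
  have hc : 0 < 1 / c := one_div_pos.2 (zero_lt_two.trans hs.two_lt_c)
  have hS := one_le_scale_succ hs.two_lt_c k
  have hμ : 0 ≤ muF μ σ := muF_nonneg hs.σ_pos hs.assumptions.μ_pos
  have hLρ : 0 ≤ Q.Lbar σ * ρ0 := mul_nonneg (sq_nonneg _) hs.ρ0_pos.le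
  have ht0 : 2 * (1 / c) ≤ t0 := by linarith [hs.two_div_lt, mul_one_div 2 c]
  have hprev : scale c k = scale c (k + 1) - 1 / c := by rw [scale_succ, add_sub_cancel_right]
  have growth : Q.Lbar σ * ρ0 * (scale c (k + 1) ^ 2 - scale c k ^ 2)
      ≤ muF μ σ / 2 * (scale c (k + 1) * (1 / c)) := by
    calc Q.Lbar σ * ρ0 * (scale c (k + 1) ^ 2 - scale c k ^ 2)
        ≤ Q.Lbar σ * ρ0 * (2 * (scale c (k + 1) * (1 / c))) :=
          mul_le_mul_of_nonneg_left (by rw [hprev]; linarith [sq_nonneg (1 / c)]) hLρ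
      _ = 2 * (Q.Lbar σ * ρ0) * (scale c (k + 1) * (1 / c)) := by ring
      _ ≤ muF μ σ / 2 * (scale c (k + 1) * (1 / c)) :=
          mul_le_mul_of_nonneg_right (by linarith [hs.ρ0_le]) (by positivity)
  have slack : scale c (k + 1) * (1 / c) ≤ scale c (k + 1) * t0 - 1 / c := by
    linarith [mul_le_mul_of_nonneg_left ht0 (zero_le_one.trans hS),
      mul_le_mul_of_nonneg_right hS hc.le]
  have := growth.trans (mul_le_mul_of_nonneg_left slack (div_nonneg hμ zero_le_two))
  rw [Problem.curvature, Problem.curvature, hs.ρ_eq]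
  nlinarith [hprev]

lemma scale_sq_mul_energy_le_lyapunov (S : Iterates p d) (xs : BlockSpace p)
    (ys : BlockSpace d) (k : ℕ) :
    scale c k ^ 2 * S.energy Q A t0 c ρ0 xs ys k ≤ S.lyapunov Q A μ L σ q t0 c ρ0 xs ys k := by
  have hρ0 := hs.ρ0_pos
  have hscale := scale_pos hs.two_lt_c k
  have hcurv := hs.curvature_pos (mul_pos hρ0 (pow_pos hscale 2))
  have hμ : 0 ≤ muF μ σ := muF_nonneg hs.σ_pos hs.assumptions.μ_pos
  have ht0 := hs.t0_pos
  have hnorm := wnormSq_nonneg hs.weight_nonneg (S.xt k - xs)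
  rw [Iterates.lyapunov, add_assoc]
  exact le_add_of_nonneg_right (by positivity)

lemma lyapunov_succ_eq (S : Iterates p d) (xs : BlockSpace p) (ys : BlockSpace d) (k : ℕ) :
    S.lyapunov Q A μ L σ q t0 c ρ0 xs ys (k + 1) = scale c (k + 1) ^ 2 *
      (S.gap Q A t0 xs ys (k + 1) + A.ρ k / 2 * ‖S.residual Q A (k + 1)‖ ^ 2
        + 1 / A.ρ k * ‖S.yh (k + 1) - ys‖ ^ 2
        + A.τ k * (A.τ k / t0 * Q.curvature L σ (A.ρ k) / 2 + muF μ σ / 2)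
          * wnormSq (fun j => σ j / q j) (S.xt (k + 1) - xs)) := by
  have hscale := (scale_pos hs.two_lt_c (k + 1)).ne'
  have hρ0 := hs.ρ0_pos.ne'
  have ht0 := hs.t0_pos.ne'
  rw [Iterates.lyapunov, Iterates.energy, hs.τ_eq, hs.ρ_eq]
  field_simp

lemma scale_sq_mul_le_lyapunov_sub (S : Iterates p d) {xs : BlockSpace p} {ys : BlockSpace d}
    {k : ℕ} (hgap : 0 ≤ S.gap Q A t0 xs ys k) :
    scale c (k + 1) ^ 2 * ((1 - A.τ k) * S.gap Q A t0 xs ys k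
        + A.ρ k / 2 * ((1 - A.τ k) ^ 2 * ‖S.residual Q A k‖ ^ 2)
        + 1 / A.ρ k * ‖S.yh k - ys‖ ^ 2
        + A.τ k * (A.τ k / t0 * Q.curvature L σ (A.ρ k) / 2 + muF μ σ / 2 * (1 - t0))
          * wnormSq (fun j => σ j / q j) (S.xt k - xs))
      ≤ S.lyapunov Q A μ L σ q t0 c ρ0 xs ys k
        - (t0 - 2 / c) * (scale c (k + 1) * S.energy Q A t0 c ρ0 xs ys k) := by
  have hscale := (scale_pos hs.two_lt_c (k + 1)).ne'
  have gap_le := mul_le_mul_of_nonneg_right (hs.scale_sq_mul_one_sub_τ_le k) hgap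
  have residual_le := mul_le_mul_of_nonneg_left (mul_le_mul_of_nonneg_right
    (hs.scale_pow_four_mul_one_sub_τ_sq_le k) (sq_nonneg ‖S.residual Q A k‖))
    (half_pos hs.ρ0_pos).le
  have norm_le := mul_le_mul_of_nonneg_right
    (mul_le_mul_of_nonneg_left (hs.curvature_succ_le k) hs.t0_pos.le)
    (wnormSq_nonneg hs.weight_nonneg (S.xt k - xs))
  have ρ_cancel : scale c (k + 1) ^ 2 * (1 / A.ρ k) = 1 / ρ0 := by
    have := hs.ρ0_pos.ne'
    rw [hs.ρ_eq]
    field_simp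
  have τ_cancel : scale c (k + 1) ^ 2
      * (A.τ k * (A.τ k / t0 * Q.curvature L σ (A.ρ k) / 2 + muF μ σ / 2 * (1 - t0)))
      = t0 * (Q.curvature L σ (A.ρ k) / 2 + muF μ σ / 2 * (scale c (k + 1) * (1 - t0))) := by
    have := hs.t0_pos.ne'
    rw [hs.τ_eq]
    field_simp
  rw [← τ_cancel] at norm_le
  rw [Iterates.lyapunov, Iterates.energy, ← ρ_cancel]
  linear_combination gap_le + residual_le + norm_le + scale c (k + 1) ^ 2 / 2
    * ((1 - A.τ k) ^ 2 * ‖S.residual Q A k‖ ^ 2) * hs.ρ_eq k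

section Run

variable {x0 : BlockSpace p} {yh0 : BlockSpace d} {jk : ℕ → Fin n} {S : Iterates p d}
  (hx0 : x0 ∈ Q.dom) (hS : IsRun Q σ t0 A x0 yh0 jk S)
include hx0 hS

section Multiplier

variable {xs : BlockSpace p} {ys : BlockSpace d} (hys : Q.IsMultiplier xs ys)
include hys

lemma energy_nonneg (k : ℕ) : 0 ≤ S.energy Q A t0 c ρ0 xs ys k := by
  have := hs.gap_nonneg hS hx0 hys k
  have := hs.ρ0_pos
  rw [Iterates.energy]
  positivity

lemma norm_residual_le (k : ℕ) :
    ‖S.residual Q A k‖ ≤ √(2 / ρ0) / scale c k * √(S.energy Q A t0 c ρ0 xs ys k) := by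
  have hscale := scale_pos hs.two_lt_c k
  have hρ0 := hs.ρ0_pos
  have hgap := hs.gap_nonneg hS hx0 hys k
  rw [div_mul_eq_mul_div, ← Real.sqrt_mul (by positivity), le_div_iff₀ hscale]
  refine Real.le_sqrt_of_sq_le ?_
  calc (‖S.residual Q A k‖ * scale c k) ^ 2
      = 2 / ρ0 * (ρ0 / 2 * (scale c k ^ 2 * ‖S.residual Q A k‖ ^ 2)) := by field_simp
    _ ≤ 2 / ρ0 * S.energy Q A t0 c ρ0 xs ys k := by
      rw [Iterates.energy]
      gcongr
      linarith

lemma FR_sub_le (k : ℕ) :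
    Q.FR (S.x k) - Q.FR xs ≤ S.energy Q A t0 c ρ0 xs ys k
      + (Mg + ‖ys‖) * (√(2 / ρ0) / scale c k * √(S.energy Q A t0 c ρ0 xs ys k)) := by
  obtain ⟨-, hf⟩ := hs.x_mem_dom_and_fR_le hS hx0 k
  have hgR := hs.assumptions.gR_le_add hs.lipschitz (Q.K (S.x k)) (S.dualPoint Q A k)
  have hinner := neg_le_of_abs_le
    (abs_real_inner_le_norm ys (Q.K (S.x k) - S.dualPoint Q A k))
  have hgap : S.gap Q A t0 xs ys k ≤ S.energy Q A t0 c ρ0 xs ys k :=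
    le_add_of_nonneg_right (mul_nonneg (half_pos hs.ρ0_pos).le (by positivity))
  have hres := mul_le_mul_of_nonneg_left (hs.norm_residual_le hx0 hS hys k)
    (add_nonneg hs.lipschitz.1 (norm_nonneg ys))
  rw [Iterates.residual] at hres
  rw [Iterates.gap, Problem.gap, Problem.lagrangian] at hgap
  rw [Problem.FR, Problem.FR] at *
  linarith

lemma lyapunov_zero_le :
    S.lyapunov Q A μ L σ q t0 c ρ0 xs ys 0 ≤ Q.FR x0 - Q.FR xs
      + t0 * (Lh L σ + 2 * Q.Lbar σ * ρ0 + muF μ σ) / 2 * wnormSq (fun j => σ j / q j) (x0 - xs)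
      + 1 / ρ0 * ‖yh0 - ys‖ ^ 2 := by
  have hscale := (scale_pos hs.two_lt_c 0).le
  have hscale1 := scale_zero_le hs.two_lt_c
  have hsq : scale c 0 ^ 2 ≤ 1 := pow_le_one₀ hscale hscale1
  have hLbar : 0 ≤ Q.Lbar σ := sq_nonneg _
  have hμ : 0 ≤ muF μ σ := muF_nonneg hs.σ_pos hs.assumptions.μ_pos
  have hρ0 := hs.ρ0_pos.le
  have hgap : 0 ≤ S.energy Q A t0 c ρ0 xs ys 0 := hs.energy_nonneg hx0 hS hys 0
  have energy_zero : S.energy Q A t0 c ρ0 xs ys 0 = Q.FR x0 - Q.FR xs := by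
    rw [Iterates.energy, Iterates.residual, Iterates.gap, Problem.gap, Problem.lagrangian,
      dualPoint_zero hS, Iterates.averagedF, hS.x_zero, Problem.FR, Problem.FR, sub_self,
      norm_zero, inner_zero_right]
    ring
  have hcoeff : Q.curvature L σ (ρ0 * scale c 0 ^ 2) / 2 + muF μ σ / 2 * scale c 0
      ≤ (Lh L σ + 2 * Q.Lbar σ * ρ0 + muF μ σ) / 2 := by
    have := mul_le_mul_of_nonneg_left hsq (mul_nonneg hLbar hρ0)
    have := mul_le_mul_of_nonneg_left hscale1 hμ
    rw [Problem.curvature]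
    linarith
  rw [Iterates.lyapunov, hS.yh_zero, hS.xt_zero, ← energy_zero, mul_div_assoc]
  have := mul_le_mul_of_nonneg_right (mul_le_mul_of_nonneg_left hcoeff hs.t0_pos.le)
    (wnormSq_nonneg hs.weight_nonneg (x0 - xs))
  linarith [mul_le_of_le_one_left hgap hsq]

lemma lyapunov_average_le (hxs : xs ∈ Q.dom) {jk' : Fin n → ℕ → Fin n} {S' : Fin n → Iterates p d}
    (hS' : ∀ i, IsRun Q σ t0 A x0 yh0 (jk' i) (S' i)) {k : ℕ}
    (hpast : ∀ i, ∀ l < k, jk l = jk' i l) (hdraw : ∀ i, jk' i k = i) :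
    ∑ i, q i * (S' i).lyapunov Q A μ L σ q t0 c ρ0 xs ys (k + 1)
      ≤ S.lyapunov Q A μ L σ q t0 c ρ0 xs ys k
        - (t0 - 2 / c) * (scale c (k + 1) * S.energy Q A t0 c ρ0 xs ys k) := by
  have agree (i : Fin n) : S.AgreeUpTo (S' i) k := hs.agreeUpTo_of_draws hS hx0 (hS' i) (hpast i)
  have hxt (i : Fin n) : (S' i).xt k = S.xt k := ((agree i).xt k le_rfl).symm
  have hxh (i : Fin n) : (S' i).xh k = S.xh k := ((agree i).xh k le_rfl).symm
  have hy (i : Fin n) : (S' i).y (k + 1) = S.y (k + 1) := ((agree i).y _ le_rfl).symm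
  have hstep := hs.assumptions.average_iteration_le hs.σ_pos hs.q_sum (hs.τ_pos k) (hs.τ_le_one k)
    hs.t0_pos hs.t0_le_q (hs.ρ_pos k) (hs.curvature_pos (hs.ρ_pos k)) (hs.xt_mem_dom hS hx0 k) hxs
    (hS.xh_eq k) (hs.y_succ_eq k) (hs.y_succ_subgradient hS k) ys (S.dualPoint Q A k)
    (S.averagedF Q A t0 k) (X := fun i => (S' i).xt (k + 1))
    (fun i l hl => by rw [(hS' i).xt_keep k l (hl.trans_eq (hdraw i).symm), hxt])
    (fun i => by
      have h := (hS' i).xt_draw k i (hdraw i).symm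
      rwa [hxt, hxh, hy, hs.β_eq] at h)
  refine le_trans (le_of_eq ?_)
    ((mul_le_mul_of_nonneg_left hstep (sq_nonneg (scale c (k + 1)))).trans
      (hs.scale_sq_mul_le_lyapunov_sub S (hs.gap_nonneg hS hx0 hys k)))
  rw [Finset.mul_sum]
  refine Finset.sum_congr rfl fun i _ => ?_
  rw [hs.lyapunov_succ_eq, mul_left_comm, hs.yh_succ_eq (hS' i), Iterates.gap, Iterates.averagedF,
    ← (agree i).averagedF_eq, ← (agree i).residual_eq, Iterates.residual, Iterates.residual,
    ← (agree i).dualPoint_eq le_rfl, (hS' i).x_succ, hxh, hxt, ← (agree i).yh k le_rfl]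

end Multiplier

end Run

end Setting

/-! ### Random draws -/

section Draws

variable {Ω : Type*} [MeasurableSpace Ω] {P : Measure Ω} [IsFiniteMeasure P]

lemma integrable_of_factorsThrough {α : Type*} [Finite α] [MeasurableSpace α]
    [MeasurableSingletonClass α] {X : Ω → α} (hX : Measurable X) {A : Ω → ℝ}
    (hA : A.FactorsThrough X) : Integrable A P := by
  have := Measure.isFiniteMeasure_map P X
  rw [← hA.extend_comp fun _ => 0]
  exact (Integrable.of_finite (μ := P.map X)).comp_measurable hX

lemma integral_le_of_average_le {α β : Type*} [Finite α] [MeasurableSpace α]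
    [MeasurableSingletonClass α] [Fintype β] [MeasurableSpace β] [MeasurableSingletonClass β]
    {X : Ω → α} {Y : Ω → β} (hX : Measurable X) (hY : Measurable Y) (hXY : IndepFun X Y P)
    (hY0 : ∀ b, P (Y ⁻¹' {b}) ≠ 0) {A B : Ω → ℝ} (hA : A.FactorsThrough fun ω => (X ω, Y ω))
    (hB : Integrable B P)
    (h : ∀ ω (ω' : β → Ω), (∀ b, X (ω' b) = X ω) → (∀ b, Y (ω' b) = b) →
      ∑ b, P.real (Y ⁻¹' {b}) * A (ω' b) ≤ B ω) : ∫ ω, A ω ∂P ≤ ∫ ω, B ω ∂P := by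
  have := Measure.isFiniteMeasure_map P X
  have := Measure.isFiniteMeasure_map P Y
  obtain ⟨a, rfl⟩ : ∃ a : α × β → ℝ, A = a ∘ fun ω => (X ω, Y ω) :=
    ⟨_, (hA.extend_comp fun _ => 0).symm⟩
  have fubini : ∫ ω, a (X ω, Y ω) ∂P = ∫ ω, ∑ b, P.real (Y ⁻¹' {b}) * a (X ω, b) ∂P := by
    rw [← integral_map (φ := fun ω => (X ω, Y ω)) (hX.prodMk hY).aemeasurable
        (Integrable.of_finite).aestronglyMeasurable,
      (indepFun_iff_map_prod_eq_prod_map_map hX.aemeasurable hY.aemeasurable).1 hXY,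
      integral_prod _ Integrable.of_finite,
      integral_map hX.aemeasurable (Integrable.of_finite).aestronglyMeasurable]
    simp only [integral_fintype Integrable.of_finite, smul_eq_mul,
      map_measureReal_apply hY (measurableSet_singleton _)]
  have charged : ∀ᵐ ω ∂P, P (X ⁻¹' {X ω}) ≠ 0 :=
    (measure_preimage_eq_zero_iff_of_countable (f := X) (s := {x | ¬ P (X ⁻¹' {x}) ≠ 0})
      (Set.to_countable _)).2 fun x hx => not_not.1 hx
  refine fubini.trans_le (integral_mono_ae ?_ hB ?_)
  · exact integrable_of_factorsThrough hX fun ω ω' hω => by simp only [hω]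
  filter_upwards [charged] with ω hω
  have realized (b : β) : (X ⁻¹' {X ω} ∩ Y ⁻¹' {b}).Nonempty := by
    refine nonempty_of_measure_ne_zero (μ := P) ?_
    rw [hXY.measure_inter_preimage_eq_mul _ _ (measurableSet_singleton _)
      (measurableSet_singleton _)]
    exact mul_ne_zero hω (hY0 b)
  choose ω' hω' using realized
  have hX' (b : β) : X (ω' b) = X ω := (hω' b).1
  have hY' (b : β) : Y (ω' b) = b := (hω' b).2
  simpa only [Function.comp_apply, hX', hY'] using h ω ω' hX' hY'

/-- The first `k` draws. -/
def history {ι : Type*} (j : ℕ → Ω → ι) (k : ℕ) (ω : Ω) : Finset.range k → ι := fun i => j i ω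

variable {ι : Type*} {j : ℕ → Ω → ι} {k : ℕ}

omit [MeasurableSpace Ω] in
lemma history_eq_iff {ω ω' : Ω} : history j k ω = history j k ω' ↔ ∀ l < k, j l ω = j l ω' := by
  simp [history, funext_iff]

variable [MeasurableSpace ι]

lemma measurable_history (hj : ∀ k, Measurable (j k)) (k : ℕ) : Measurable (history j k) :=
  measurable_pi_lambda _ fun i => hj i

omit [IsFiniteMeasure P] in
lemma indepFun_history (hj : ∀ k, Measurable (j k)) (hind : iIndepFun j P) (k : ℕ) :
    IndepFun (history j k) (j k) P :=
  (hind.indepFun_finset (Finset.range k) {k} (by simp) hj).comp measurable_id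
    (measurable_pi_apply (⟨k, Finset.mem_singleton_self k⟩ : ({k} : Finset ℕ)))

end Draws

/-! ### Summable energies and rates -/

section Sequences

lemma summable_of_le_sub {V D : ℕ → ℝ} (hV : ∀ k, 0 ≤ V k) (hD : ∀ k, 0 ≤ D k)
    (h : ∀ k, V (k + 1) ≤ V k - D k) : Summable D := by
  have partial_sum_le (N : ℕ) : ∑ k ∈ Finset.range N, D k ≤ V 0 - V N := by
    rw [← Finset.sum_range_sub']
    exact Finset.sum_le_sum fun k _ => le_sub_comm.1 (h k)
  exact summable_of_sum_range_le hD fun N => (partial_sum_le N).trans (sub_le_self _ (hV N))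

lemma not_summable_one_div_mul_one_add_log :
    ¬ Summable fun k : ℕ => 1 / ((k : ℝ) * (1 + Real.log k)) := by
  have hlog (k : ℕ) : 0 ≤ Real.log k := Real.log_natCast_nonneg k
  rw [← summable_condensed_iff_of_nonneg (fun k => by have := hlog k; positivity)
    fun {a b} ha _ => by have := hlog a; gcongr]
  have harmonic_le (k : ℕ) : 1 / ((k + 1 : ℕ) : ℝ)
      ≤ (2 : ℝ) ^ k * (1 / (((2 ^ k : ℕ) : ℝ) * (1 + Real.log ((2 ^ k : ℕ) : ℝ)))) := by
    have hlog2 : Real.log 2 ≤ 1 := by linarith [Real.log_two_lt_d9]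
    have hk : k * Real.log 2 ≤ k := mul_le_of_le_one_right k.cast_nonneg hlog2
    push_cast
    rw [Real.log_pow, mul_one_div, div_mul_cancel_left₀ (by positivity), ← one_div]
    exact one_div_le_one_div_of_le (by positivity) (by linarith)
  exact fun h => Real.not_summable_one_div_natCast ((summable_nat_add_iff 1).1
    (.of_nonneg_of_le (fun k => by positivity) harmonic_le h))

lemma one_le_log {x : ℝ} (hx : 3 ≤ x) : 1 ≤ Real.log x :=
  (Real.le_log_iff_exp_le (by linarith)).2 (by linarith [Real.exp_one_lt_d9])

lemma frequently_mul_log_mul_lt {t : ℕ → ℝ} (ht : Summable t) {ε : ℝ} (hε : 0 < ε) :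
    ∃ᶠ k : ℕ in atTop, k * Real.log k * t k < ε := by
  intro hev
  refine not_summable_one_div_mul_one_add_log
    ((ht.mul_left (2 / ε)).of_norm_bounded_eventually_nat ?_)
  filter_upwards [hev, eventually_ge_atTop 3] with k hk hk3
  have hk3 : (3 : ℝ) ≤ k := mod_cast hk3
  have hlog := one_le_log hk3
  have hε_le : ε ≤ k * Real.log k * t k := not_lt.1 hk
  have ht : 0 < t k := pos_of_mul_pos_right (hε.trans_le hε_le) (by positivity)
  rw [Real.norm_of_nonneg (by positivity), div_mul_eq_mul_div,
    div_le_div_iff₀ (by positivity) hε]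
  nlinarith [mul_pos (by linarith : (0 : ℝ) < k) ht]

lemma frequently_sq_mul_sqrt_log_mul_le {e u : ℕ → ℝ} {C : ℝ} (hC : 0 ≤ C) (he : ∀ k, 0 ≤ e k)
    (hu : ∀ k, 0 < k → u k ≤ e k + C * (√(e k) / k)) (hsum : Summable fun k : ℕ => k * e k)
    {ε : ℝ} (hε : 0 < ε) : ∃ᶠ k : ℕ in atTop, (k : ℝ) ^ 2 * √(Real.log k) * u k ≤ ε := by
  obtain ⟨δ, hδ, hδ1, hδε⟩ : ∃ δ : ℝ, 0 < δ ∧ δ ≤ 1 ∧ (1 + C) * δ ≤ ε :=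
    ⟨min 1 (ε / (1 + C)), by positivity, min_le_left _ _,
      (le_div_iff₀' (by positivity)).1 (min_le_right _ _)⟩
  refine ((frequently_mul_log_mul_lt hsum (pow_pos hδ 2)).and_eventually
    (eventually_ge_atTop 3)).mono fun k ⟨hk, hk_ge⟩ => ?_
  have hk3 : (3 : ℝ) ≤ k := mod_cast hk_ge
  have hlog := one_le_log hk3
  have hek := he k
  have small : (k : ℝ) ^ 2 * Real.log k * e k ≤ δ ^ 2 := by linarith [hk]
  have linear_term : (k : ℝ) ^ 2 * √(Real.log k) * e k ≤ δ :=
    calc (k : ℝ) ^ 2 * √(Real.log k) * e k ≤ (k : ℝ) ^ 2 * Real.log k * e k := by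
          gcongr
          exact Real.sqrt_le_iff.2 ⟨by positivity, le_self_pow₀ hlog two_ne_zero⟩
      _ ≤ δ := small.trans (pow_le_of_le_one hδ.le hδ1 two_ne_zero)
  have sqrt_term : (k : ℝ) ^ 2 * √(Real.log k) * (√(e k) / k) ≤ δ :=
    calc (k : ℝ) ^ 2 * √(Real.log k) * (√(e k) / k)
        = √((k : ℝ) ^ 2 * Real.log k * e k) := by
          rw [Real.sqrt_mul (by positivity), Real.sqrt_mul (by positivity),
            Real.sqrt_sq (by positivity)]
          field_simp
      _ ≤ δ := Real.sqrt_le_iff.2 ⟨hδ.le, small⟩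
  calc (k : ℝ) ^ 2 * √(Real.log k) * u k
      ≤ (k : ℝ) ^ 2 * √(Real.log k) * (e k + C * (√(e k) / k)) := by
        gcongr
        exact hu k (by lia)
    _ = (k : ℝ) ^ 2 * √(Real.log k) * e k
        + C * ((k : ℝ) ^ 2 * √(Real.log k) * (√(e k) / k)) := by ring
    _ ≤ δ + C * δ := by gcongr
    _ ≤ ε := by linarith

lemma liminf_coe_eq_zero {α : Type*} {l : Filter α} {v : α → ℝ} (hv : ∀ a, 0 ≤ v a)
    (h : ∀ ε > 0, ∃ᶠ a in l, v a ≤ ε) : liminf (fun a => (v a : EReal)) l = 0 := by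
  refine le_antisymm (le_of_forall_gt fun x hx => ?_)
    (le_liminf_of_le (by isBoundedDefault) (.of_forall fun a => EReal.coe_nonneg.2 (hv a)))
  obtain ⟨ε, hε, hεx⟩ := EReal.lt_iff_exists_real_btwn.1 hx
  exact (liminf_le_of_frequently_le' ((h ε (EReal.coe_pos.1 hε)).mono fun a ha =>
    EReal.coe_le_coe_iff.2 ha)).trans_lt hεx

lemma isLiminfLittleO_one_div {u v : ℕ → ℝ}
    (h : liminf (fun k => ((v k * u k : ℝ) : EReal)) atTop = 0) :
    IsLiminfLittleO u fun k => 1 / v k := by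
  simpa only [IsLiminfLittleO, div_div_eq_mul_div, div_one, mul_comm] using h

end Sequences

/-! ### The randomized method -/

/-- Runs of the method from `(x0, yh0)` in which the block of each iteration is drawn independently
with distribution `q`. -/
structure IsRandomRun {n m : ℕ} {p : Fin n → ℕ} {d : Fin m → ℕ} (Q : Problem n m p d)
    (σ q : Fin n → ℝ) (t0 : ℝ) (A : Params) (x0 : BlockSpace p) (yh0 : BlockSpace d) {Ω : Type*}
    [MeasurableSpace Ω] (P : Measure Ω) (j : ℕ → Ω → Fin n) (S : Ω → Iterates p d) : Prop where
  measurable : ∀ k, Measurable (j k)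
  indep : iIndepFun j P
  law : ∀ k i, P {ω | j k ω = i} = ENNReal.ofReal (q i)
  run : ∀ ω, IsRun Q σ t0 A x0 yh0 (fun k => j k ω) (S ω)

namespace Setting

variable {n m : ℕ} {p : Fin n → ℕ} {d : Fin m → ℕ} {Q : Problem n m p d} {μ L σ q : Fin n → ℝ}
  {Mg t0 c ρ0 : ℝ} {A : Params} (hs : Setting Q μ L σ q Mg t0 c ρ0 A)
  {x0 : BlockSpace p} {yh0 : BlockSpace d} {Ω : Type*} [MeasurableSpace Ω] {P : Measure Ω}
  {j : ℕ → Ω → Fin n} {S : Ω → Iterates p d} (hx0 : x0 ∈ Q.dom)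
  (hR : IsRandomRun Q σ q t0 A x0 yh0 P j S)
include hs hx0 hR

lemma factorsThrough_history {α : Type*} {Φ : Iterates p d → α} {k : ℕ}
    (hΦ : ∀ S S' : Iterates p d, S.AgreeUpTo S' k → Φ S = Φ S') :
    (fun ω => Φ (S ω)).FactorsThrough (history j k) := fun ω ω' h =>
  hΦ _ _ (hs.agreeUpTo_of_draws (hR.run ω) hx0 (hR.run ω') (history_eq_iff.1 h))

lemma F_ne_top (ω : Ω) (k : ℕ) : Q.F ((S ω).x k) ≠ ⊤ :=
  (hs.assumptions.F_ne_top_iff hs.lipschitz).2 (hs.x_mem_dom_and_fR_le (hR.run ω) hx0 k).1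

lemma toReal_F_eq (ω : Ω) (k : ℕ) : (Q.F ((S ω).x k)).toReal = Q.FR ((S ω).x k) := by
  rw [hs.assumptions.F_eq_coe hs.lipschitz (hs.x_mem_dom_and_fR_le (hR.run ω) hx0 k).1,
    EReal.toReal_coe]

variable [IsProbabilityMeasure P]

lemma integrable_of_agreeUpTo (Φ : Iterates p d → ℝ) (k : ℕ)
    (hΦ : ∀ S S' : Iterates p d, S.AgreeUpTo S' k → Φ S = Φ S') :
    Integrable (fun ω => Φ (S ω)) P :=
  integrable_of_factorsThrough (measurable_history hR.measurable k)
    (hs.factorsThrough_history hx0 hR hΦ)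

lemma integrable_FR (k : ℕ) : Integrable (fun ω => Q.FR ((S ω).x k)) P :=
  hs.integrable_of_agreeUpTo hx0 hR (fun S => Q.FR (S.x k)) k fun _ _ h => by rw [h.x k le_rfl]

lemma integrable_energy (xs : BlockSpace p) (ys : BlockSpace d) (k : ℕ) :
    Integrable (fun ω => (S ω).energy Q A t0 c ρ0 xs ys k) P :=
  hs.integrable_of_agreeUpTo hx0 hR _ k fun _ _ h => h.energy_eq t0 c ρ0 xs ys

lemma integrable_sqrt_energy (xs : BlockSpace p) (ys : BlockSpace d) (k : ℕ) :
    Integrable (fun ω => √((S ω).energy Q A t0 c ρ0 xs ys k)) P :=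
  hs.integrable_of_agreeUpTo hx0 hR (fun S => √(S.energy Q A t0 c ρ0 xs ys k)) k
    fun _ _ h => by rw [h.energy_eq t0 c ρ0 xs ys]

lemma integrable_lyapunov (xs : BlockSpace p) (ys : BlockSpace d) (k : ℕ) :
    Integrable (fun ω => (S ω).lyapunov Q A μ L σ q t0 c ρ0 xs ys k) P :=
  hs.integrable_of_agreeUpTo hx0 hR _ k fun _ _ h => h.lyapunov_eq μ L σ q t0 c ρ0 xs ys

lemma scale_sq_mul_integral_energy_le (xs : BlockSpace p) (ys : BlockSpace d) (k : ℕ) :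
    scale c k ^ 2 * ∫ ω, (S ω).energy Q A t0 c ρ0 xs ys k ∂P
      ≤ ∫ ω, (S ω).lyapunov Q A μ L σ q t0 c ρ0 xs ys k ∂P := by
  rw [← integral_const_mul]
  exact integral_mono ((hs.integrable_energy hx0 hR xs ys k).const_mul _)
    (hs.integrable_lyapunov hx0 hR xs ys k)
    fun ω => hs.scale_sq_mul_energy_le_lyapunov (S ω) xs ys k

section Multiplier

variable {xs : BlockSpace p} {ys : BlockSpace d} (hys : Q.IsMultiplier xs ys)
include hys

omit [IsProbabilityMeasure P] in
lemma integral_energy_nonneg (k : ℕ) : 0 ≤ ∫ ω, (S ω).energy Q A t0 c ρ0 xs ys k ∂P :=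
  integral_nonneg fun ω => hs.energy_nonneg hx0 (hR.run ω) hys k

lemma integral_FR_sub_le (k : ℕ) :
    ∫ ω, (Q.FR ((S ω).x k) - Q.FR xs) ∂P ≤ ∫ ω, (S ω).energy Q A t0 c ρ0 xs ys k ∂P
      + (Mg + ‖ys‖) * (√(2 / ρ0) / scale c k
        * √(∫ ω, (S ω).energy Q A t0 c ρ0 xs ys k ∂P)) := by
  have int_energy := hs.integrable_energy hx0 hR xs ys k
  have int_sqrt := hs.integrable_sqrt_energy hx0 hR xs ys k
  have jensen : ∫ ω, √((S ω).energy Q A t0 c ρ0 xs ys k) ∂P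
      ≤ √(∫ ω, (S ω).energy Q A t0 c ρ0 xs ys k ∂P) :=
    Real.strictConcaveOn_sqrt.concaveOn.le_map_integral Real.continuous_sqrt.continuousOn
      isClosed_Ici (.of_forall fun ω => hs.energy_nonneg hx0 (hR.run ω) hys k) int_energy int_sqrt
  have hscale := (scale_pos hs.two_lt_c k).le
  have hM := add_nonneg hs.lipschitz.1 (norm_nonneg ys)
  calc ∫ ω, (Q.FR ((S ω).x k) - Q.FR xs) ∂P
      ≤ ∫ ω, ((S ω).energy Q A t0 c ρ0 xs ys k + (Mg + ‖ys‖) * (√(2 / ρ0) / scale c k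
          * √((S ω).energy Q A t0 c ρ0 xs ys k))) ∂P :=
        integral_mono ((hs.integrable_FR hx0 hR k).sub (integrable_const _))
          (int_energy.add ((int_sqrt.const_mul _).const_mul _))
          fun ω => hs.FR_sub_le hx0 (hR.run ω) hys k
    _ = ∫ ω, (S ω).energy Q A t0 c ρ0 xs ys k ∂P + (Mg + ‖ys‖) * (√(2 / ρ0) / scale c k
          * ∫ ω, √((S ω).energy Q A t0 c ρ0 xs ys k) ∂P) := by
        rw [integral_add int_energy ((int_sqrt.const_mul _).const_mul _), integral_const_mul,
          integral_const_mul]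
    _ ≤ _ := by gcongr

variable (hxs : xs ∈ Q.dom)
include hxs

lemma integral_lyapunov_succ_le (k : ℕ) :
    ∫ ω, (S ω).lyapunov Q A μ L σ q t0 c ρ0 xs ys (k + 1) ∂P
      ≤ ∫ ω, (S ω).lyapunov Q A μ L σ q t0 c ρ0 xs ys k ∂P
        - (t0 - 2 / c) * (scale c (k + 1) * ∫ ω, (S ω).energy Q A t0 c ρ0 xs ys k ∂P) := by
  have int_lyapunov := hs.integrable_lyapunov hx0 hR xs ys k
  have int_decrease := ((hs.integrable_energy hx0 hR xs ys k).const_mul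
    (scale c (k + 1))).const_mul (t0 - 2 / c)
  have law (i : Fin n) : P (j k ⁻¹' {i}) = ENNReal.ofReal (q i) := hR.law k i
  rw [← integral_const_mul, ← integral_const_mul, ← integral_sub int_lyapunov int_decrease]
  refine integral_le_of_average_le (measurable_history hR.measurable k) (hR.measurable k)
    (indepFun_history hR.measurable hR.indep k)
    (fun i => by simpa only [law, ne_eq, ENNReal.ofReal_eq_zero, not_le] using hs.q_pos i)
    (fun ω ω' h => ?_) (int_lyapunov.sub int_decrease) fun ω ω' hpast hdraw => ?_
  · obtain ⟨hpast, hdraw⟩ := Prod.ext_iff.1 h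
    refine hs.factorsThrough_history hx0 hR (k := k + 1)
      (fun _ _ h => h.lyapunov_eq μ L σ q t0 c ρ0 xs ys) (history_eq_iff.2 fun l hl => ?_)
    exact (Nat.lt_succ_iff_lt_or_eq.1 hl).elim (history_eq_iff.1 hpast l) (· ▸ hdraw)
  · simp only [measureReal_def, law, ENNReal.toReal_ofReal (hs.q_pos _).le]
    exact hs.lyapunov_average_le hx0 (hR.run ω) hys hxs (fun i => hR.run (ω' i))
      (fun i => history_eq_iff.1 (hpast i).symm) hdraw

lemma summable_mul_integral_energy :
    Summable fun k : ℕ => k * ∫ ω, (S ω).energy Q A t0 c ρ0 xs ys k ∂P := by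
  have hc := hs.two_lt_c
  have ht0 : 0 < t0 - 2 / c := sub_pos.2 hs.two_div_lt
  have energy_nonneg (k : ℕ) := hs.integral_energy_nonneg hx0 hR hys k
  have scale_energy_summable := (summable_mul_left_iff ht0.ne').1 <| summable_of_le_sub
    (fun k => (mul_nonneg (sq_nonneg _) (energy_nonneg k)).trans
      (hs.scale_sq_mul_integral_energy_le hx0 hR xs ys k))
    (fun k => mul_nonneg ht0.le (mul_nonneg (scale_pos hc _).le (energy_nonneg k)))
    (hs.integral_lyapunov_succ_le hx0 hR hys hxs)
  refine (scale_energy_summable.mul_left c).of_nonneg_of_le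
    (fun k => mul_nonneg k.cast_nonneg (energy_nonneg k)) fun k => ?_
  rw [← mul_assoc]
  refine mul_le_mul_of_nonneg_right ((le_mul_scale hc k).trans ?_) (energy_nonneg k)
  exact mul_le_mul_of_nonneg_left (scale_mono hc k.le_succ) (zero_lt_two.trans hc).le

lemma frequently_integral_FR_sub_le {ε : ℝ} (hε : 0 < ε) : ∃ᶠ k : ℕ in atTop,
    (k : ℝ) ^ 2 * √(Real.log k) * ∫ ω, (Q.FR ((S ω).x k) - Q.FR xs) ∂P ≤ ε := by
  have hc : 0 < c := zero_lt_two.trans hs.two_lt_c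
  have hM := add_nonneg hs.lipschitz.1 (norm_nonneg ys)
  refine frequently_sq_mul_sqrt_log_mul_le (C := (Mg + ‖ys‖) * (√(2 / ρ0) * c)) (by positivity)
    (hs.integral_energy_nonneg hx0 hR hys) (fun k hk => ?_)
    (hs.summable_mul_integral_energy hx0 hR hys hxs) hε
  have hk : (0 : ℝ) < k := Nat.cast_pos.2 hk
  have hscale : 1 / scale c k ≤ c / k := by
    rw [div_le_div_iff₀ (scale_pos hs.two_lt_c k) hk, one_mul]
    exact le_mul_scale hs.two_lt_c k
  calc ∫ ω, (Q.FR ((S ω).x k) - Q.FR xs) ∂P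
      ≤ ∫ ω, (S ω).energy Q A t0 c ρ0 xs ys k ∂P + (Mg + ‖ys‖) * (√(2 / ρ0) * (1 / scale c k)
        * √(∫ ω, (S ω).energy Q A t0 c ρ0 xs ys k ∂P)) := by
        rw [mul_one_div]
        exact hs.integral_FR_sub_le hx0 hR hys k
    _ ≤ ∫ ω, (S ω).energy Q A t0 c ρ0 xs ys k ∂P + (Mg + ‖ys‖) * (√(2 / ρ0) * (c / k)
        * √(∫ ω, (S ω).energy Q A t0 c ρ0 xs ys k ∂P)) := by gcongr
    _ = _ := by ring

end Multiplier

variable {xs : BlockSpace p} (hxs : Q.IsPrimalSolution xs)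
include hxs

lemma liminf_integral_FR_sub_eq_zero :
    liminf (fun k : ℕ => (((k : ℝ) ^ 2 * √(Real.log k) *
      ∫ ω, (Q.FR ((S ω).x k) - Q.FR xs) ∂P : ℝ) : EReal)) atTop = 0 := by
  have hQ := hs.assumptions
  have hg := hs.lipschitz
  obtain ⟨ys, hys⟩ := hxs.exists_isMultiplier hQ hg hx0
  have gap_nonneg (k : ℕ) : 0 ≤ ∫ ω, (Q.FR ((S ω).x k) - Q.FR xs) ∂P :=
    integral_nonneg fun ω => sub_nonneg.2
      (hxs.FR_le hQ hg (hs.x_mem_dom_and_fR_le (hR.run ω) hx0 k).1)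
  exact liminf_coe_eq_zero (fun k => mul_nonneg (by positivity) (gap_nonneg k)) fun ε hε =>
    hs.frequently_integral_FR_sub_le hx0 hR hys (hxs.mem_dom hQ hg hx0) hε

variable {ys : BlockSpace d} (hys : Q.IsMultiplier xs ys)
include hys

lemma integral_lyapunov_le_E0sq (k : ℕ) :
    ∫ ω, (S ω).lyapunov Q A μ L σ q t0 c ρ0 xs ys k ∂P
      ≤ E0sq Q μ L σ q t0 ρ0 x0 xs yh0 ys := by
  have hQ := hs.assumptions
  have hxs_dom := hxs.mem_dom hQ hs.lipschitz hx0
  induction k with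
  | zero =>
    have initial (ω : Ω) : (S ω).lyapunov Q A μ L σ q t0 c ρ0 xs ys 0
        ≤ E0sq Q μ L σ q t0 ρ0 x0 xs yh0 ys := by
      rw [E0sq, hxs.toReal_Fstar hQ hs.lipschitz hx0, hQ.F_eq_coe hs.lipschitz hx0,
        EReal.toReal_coe]
      exact hs.lyapunov_zero_le hx0 (hR.run ω) hys
    exact (integral_mono (hs.integrable_lyapunov hx0 hR xs ys 0) (integrable_const _)
      initial).trans_eq (by simp)
  | succ k ih =>
    have decrease_nonneg := mul_nonneg (sub_pos.2 hs.two_div_lt).le (mul_nonneg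
      (scale_pos hs.two_lt_c (k + 1)).le (hs.integral_energy_nonneg hx0 hR hys k))
    exact (hs.integral_lyapunov_succ_le hx0 hR hys hxs_dom k).trans
      ((sub_le_self _ decrease_nonneg).trans ih)

lemma integral_FR_sub_le_rate (k : ℕ) :
    ∫ ω, (Q.FR ((S ω).x k) - Q.FR xs) ∂P
      ≤ (c ^ 2 * E0sq Q μ L σ q t0 ρ0 x0 xs yh0 ys
          + c ^ 2 * (Mg + ‖ys‖) * √(E0sq Q μ L σ q t0 ρ0 x0 xs yh0 ys) * √(2 / ρ0))
        / ((k : ℝ) + c - 1) ^ 2 := by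
  set E := E0sq Q μ L σ q t0 ρ0 x0 xs yh0 ys
  have := (zero_lt_two.trans hs.two_lt_c).ne'
  have hscale := scale_pos hs.two_lt_c k
  have hM := add_nonneg hs.lipschitz.1 (norm_nonneg ys)
  have energy_le : ∫ ω, (S ω).energy Q A t0 c ρ0 xs ys k ∂P ≤ E / scale c k ^ 2 := by
    rw [le_div_iff₀' (by positivity)]
    exact (hs.scale_sq_mul_integral_energy_le hx0 hR xs ys k).trans
      (hs.integral_lyapunov_le_E0sq hx0 hR hxs hys k)
  calc ∫ ω, (Q.FR ((S ω).x k) - Q.FR xs) ∂P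
      ≤ E / scale c k ^ 2
        + (Mg + ‖ys‖) * (√(2 / ρ0) / scale c k * √(E / scale c k ^ 2)) :=
        (hs.integral_FR_sub_le hx0 hR hys k).trans (by gcongr)
    _ = (E + (Mg + ‖ys‖) * √E * √(2 / ρ0)) / scale c k ^ 2 := by
        rw [Real.sqrt_div' _ (sq_nonneg _), Real.sqrt_sq hscale.le]
        field_simp
    _ = _ := by
        rw [scale, div_pow, div_div_eq_mul_div]
        ring

end Setting

end SemiRandPD

end

theorem theorem4p3_general {n m : ℕ} {p : Fin n → ℕ} {d : Fin m → ℕ}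
    {Q : SemiRandPD.Problem n m p d} {μ L σ q : Fin n → ℝ} {Mg τ₀ c ρ₀ : ℝ} {A : SemiRandPD.Params}
    (hs : SemiRandPD.Setting Q μ L σ q Mg τ₀ c ρ₀ A) (hne : ∃ x, Q.IsPrimalSolution x)
    {x₀ : SemiRandPD.BlockSpace p} (hx₀ : Q.F x₀ ≠ ⊤) {yh₀ : SemiRandPD.BlockSpace d}
    {Ω : Type*} [MeasurableSpace Ω] {P : Measure Ω} [IsProbabilityMeasure P] {j : ℕ → Ω → Fin n}
    {S : Ω → SemiRandPD.Iterates p d}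
    (hR : SemiRandPD.IsRandomRun Q σ q τ₀ A x₀ yh₀ P j S) :
    (∀ k, (∀ᵐ ω ∂P, Q.F ((S ω).x k) ≠ ⊤) ∧
      Integrable (fun ω => (Q.F ((S ω).x k)).toReal) P) ∧
    (∀ xs ys, Q.IsPrimalSolution xs → Q.IsDualSolution ys → ∀ k : ℕ,
      ∫ ω, ((Q.F ((S ω).x k)).toReal - Q.Fstar.toReal) ∂P ≤
        (c ^ 2 * SemiRandPD.E0sq Q μ L σ q τ₀ ρ₀ x₀ xs yh₀ ys
          + c ^ 2 * (Mg + ‖ys‖) * √(SemiRandPD.E0sq Q μ L σ q τ₀ ρ₀ x₀ xs yh₀ ys) * √(2 / ρ₀))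
          / ((k : ℝ) + c - 1) ^ 2) ∧
    liminf (fun k : ℕ => (((k : ℝ) ^ 2 * √(Real.log k) *
      ∫ ω, ((Q.F ((S ω).x k)).toReal - Q.Fstar.toReal) ∂P : ℝ) : EReal)) atTop = 0 ∧
    SemiRandPD.IsLiminfLittleO
      (fun k => (∫ ω, (Q.F ((S ω).x k)).toReal ∂P) - Q.Fstar.toReal)
      (fun k => 1 / ((k : ℝ) ^ 2 * √(Real.log k))) := by
  have hQ := hs.assumptions
  have hg := hs.lipschitz
  have hx₀ := (hQ.F_ne_top_iff hg).1 hx₀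
  have integrable_F := hs.integrable_FR hx₀ hR
  have hlim := hs.liminf_integral_FR_sub_eq_zero hx₀ hR hne.choose_spec
  simp only [hs.toReal_F_eq hx₀ hR, hne.choose_spec.toReal_Fstar hQ hg hx₀]
  refine ⟨fun k => ⟨.of_forall fun ω => hs.F_ne_top hx₀ hR ω k, integrable_F k⟩,
    fun xs ys hxs hys k => ?_, hlim, SemiRandPD.isLiminfLittleO_one_div ?_⟩
  · rw [← hne.choose_spec.toReal_Fstar hQ hg hx₀, hxs.toReal_Fstar hQ hg hx₀]
    exact hs.integral_FR_sub_le_rate hx₀ hR hxs (hys.isMultiplier hQ hg hxs hx₀) k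
  · simpa only [integral_sub (integrable_F _) (integrable_const _), integral_const, probReal_univ,
      one_smul] using hlim

theorem theorem4p3
    {n m : ℕ} [NeZero n] [NeZero m] {p : Fin n → ℕ} {d : Fin m → ℕ}
    (Q : SemiRandPD.Problem n m p d)
    -- convexity and smoothness moduli, weights, probability vectors
    (μ L σ : Fin n → ℝ) (hQ : Q.Assumptions μ L)
    (hσ : ∀ j, 0 < σ j)
    (qhat : Fin m → ℝ) (hqhat : SemiRandPD.IsPosProb qhat)
    (q : Fin n → ℝ) (hq : ∀ j, q j = 1 / (n : ℝ))
    (Mg : ℝ) (hg : SemiRandPD.IsLipschitzFun Mg Q.g)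
    (hne : ∃ x, Q.IsPrimalSolution x)
    -- algorithmic parameters
    (τ₀ : ℝ) (hτ₀ : τ₀ = SemiRandPD.tau0 qhat q)
    (c : ℝ) (hc : 2 < c) (hcτ : 2 < c * τ₀)
    (ρ₀ : ℝ) (hρ₀ : 0 < ρ₀) (hρ₀' : 8 * Q.Lbar σ * ρ₀ ≤ SemiRandPD.muF μ σ)
    -- the step size `β_k` is well defined
    (hLpos : 0 < Q.Lbar σ + SemiRandPD.Lh L σ)
    -- initial point
    (x₀ : SemiRandPD.BlockSpace p) (hx₀ : Q.F x₀ ≠ ⊤) (yh₀ : SemiRandPD.BlockSpace d)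
    -- independent random indices, each distributed according to `q`
    {Ω : Type*} [MeasurableSpace Ω] (P : Measure Ω) [IsProbabilityMeasure P]
    (j : ℕ → Ω → Fin n) (hjm : ∀ k, Measurable (j k)) (hji : iIndepFun j P)
    (hjq : ∀ k i, P {ω | j k ω = i} = ENNReal.ofReal (q i))
    -- the iterates
    (S : Ω → SemiRandPD.Iterates p d)
    (hS : ∀ ω, SemiRandPD.IsRun Q σ τ₀
      (SemiRandPD.paramRule c τ₀ ρ₀ (Q.Lbar σ) (SemiRandPD.Lh L σ)) x₀ yh₀
      (fun k => j k ω) (S ω)) :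
    -- the expectations are expectations of finite integrable quantities
    (∀ k, (∀ᵐ ω ∂P, Q.F ((S ω).x k) ≠ ⊤) ∧
      Integrable (fun ω => (Q.F ((S ω).x k)).toReal) P) ∧
    -- the bound, for every primal solution `xs` and every dual solution `ys`
    (∀ xs ys, Q.IsPrimalSolution xs → Q.IsDualSolution ys → ∀ k : ℕ,
      ∫ ω, ((Q.F ((S ω).x k)).toReal - Q.Fstar.toReal) ∂P ≤
        (c ^ 2 * SemiRandPD.E0sq Q μ L σ q τ₀ ρ₀ x₀ xs yh₀ ys
          + c ^ 2 * (Mg + ‖ys‖) * √(SemiRandPD.E0sq Q μ L σ q τ₀ ρ₀ x₀ xs yh₀ ys) * √(2 / ρ₀))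
          / ((k : ℝ) + c - 1) ^ 2) ∧
    -- the lower limit
    liminf (fun k : ℕ => (((k : ℝ) ^ 2 * √(Real.log k) *
      ∫ ω, ((Q.F ((S ω).x k)).toReal - Q.Fstar.toReal) ∂P : ℝ) : EReal)) atTop = 0 ∧
    -- the rate
    SemiRandPD.IsLiminfLittleO
      (fun k => (∫ ω, (Q.F ((S ω).x k)).toReal ∂P) - Q.Fstar.toReal)
      (fun k => 1 / ((k : ℝ) ^ 2 * √(Real.log k))) :=
  theorem4p3_general
    ⟨hQ, hg, hσ, by simp [hq], fun i => hτ₀.trans_le ((min_le_right _ _).trans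
      (ciInf_le (Set.finite_range q).bddBelow i)), hc, hcτ, hρ₀, hρ₀', hLpos, rfl⟩
    hne hx₀ ⟨hjm, hji, hjq, hS⟩
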